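/- Let $n\ge 1$, $\alpha>0$, $\varepsilon>0$, and let $M^n$ be a connected smooth manifold without boundary. Let $F:M^n\times[-\varepsilon,\varepsilon]\to\mathbb{R}^{n+1}$ be a smooth map such that each $F(\cdot,t)$ is a strictly convex immersion (not necessarily complete), with smooth unit normal $\nu$, which is a solution of the $\alpha$-Gauss curvature flow $\partial_t F=-K^\alpha\nu$. Here $g_{ij}=\langle\nabla_iF,\nabla_jF\rangle$ is the induced metric with Levi-Civita connection $\nabla$, $h_{ij}=-\langle\partial^2_{ij}F,\nu\rangle$ is the second fundamental form, strict convexity means that $h_{ij}$ is positive definite (so that $\nu$ points to the outer side), $b^{ij}$ is the inverse of $h_{ij}$, and $K=\det(g^{ij})\det(h_{ij})$ is the Gauss curvature. Put $$P_{ij}=\nabla^2_{ij}K^\alpha-b^{ml}\nabla_mh_{ij}\nabla_lK^\alpha+K^\alpha h^k_ih_{kj},\qquad P=\frac{1}{\alpha K^\alpha}\bigl(\partial_tK^\alpha-b^{ij}\nabla_iK^\alpha\nabla_jK^\alpha\bigr),\qquad T=b^{ij}\nabla_iK^\alpha\nabla_jF+K^\alpha\nu .$$ Suppose that $P\equiv0$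 on $M^n\times[-\varepsilon,\varepsilon]$. Then $P_{ij}\equiv0$ on $M^n\times[-\varepsilon,\varepsilon]$, the vector $T$ is constant on $M^n\times[-\varepsilon,\varepsilon]$, and $F(M^n,0)$ is a translating soliton with velocity $-T$; that is, the translates $F(\cdot,0)-tT$, $t\in\mathbb{R}$, are strictly convex hypersurfaces moving with normal velocity $\langle -T,\nu\rangle=-K^\alpha$. -/

import Mathlib

open Set
open scoped Manifold ContDiff Matrix

noncomputable section

namespace GCF

/-- Euclidean space `ℝⁿ`. -/
abbrev Euc (n : ℕ) : Type := EuclideanSpace ℝ (Fin n)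

/-! ### Geometry of a parametrized hypersurface

`X : ℝⁿ → ℝⁿ⁺¹` is a local parametrization, `N` a unit normal field along it (in the same
coordinates). All objects are given by their components in the coordinates `x¹, …, xⁿ`. -/

section Coordinates

variable {n : ℕ}

/-- The partial derivative `∂ᵢ f` at `x`. -/
def pd {V : Type*} [NormedAddCommGroup V] [NormedSpace ℝ V]
    (i : Fin n) (f : Euc n → V) (x : Euc n) : V :=
  fderiv ℝ f x (EuclideanSpace.single i (1 : ℝ))

/-- The induced metric `gᵢⱼ = ⟨∂ᵢX, ∂ⱼX⟩`. -/
def metric (X : Euc n → Euc (n + 1)) (x : Euc n) : Matrix (Fin n) (Fin n) ℝ :=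
  Matrix.of fun i j => inner ℝ (pd i X x) (pd j X x)

/-- The second fundamental form `hᵢⱼ = -⟨∂ᵢ∂ⱼX, N⟩` (positive for a sphere and its outward
normal). -/
def secondForm (X N : Euc n → Euc (n + 1)) (x : Euc n) : Matrix (Fin n) (Fin n) ℝ :=
  Matrix.of fun i j => -inner ℝ (pd i (pd j X) x) (N x)

/-- The inverse `bⁱʲ` of the second fundamental form. -/
def invSecondForm (X N : Euc n → Euc (n + 1)) (x : Euc n) : Matrix (Fin n) (Fin n) ℝ :=
  (secondForm X N x)⁻¹

/-- The Gauss curvature `K = (det gⁱʲ) (det hᵢⱼ)`. -/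
def gaussCurvature (X N : Euc n → Euc (n + 1)) (x : Euc n) : ℝ :=
  ((metric X x)⁻¹).det * (secondForm X N x).det

/-- The speed `K^α`. -/
def speed (α : ℝ) (X N : Euc n → Euc (n + 1)) (x : Euc n) : ℝ :=
  gaussCurvature X N x ^ α

/-- The Christoffel symbols `Γᵏᵢⱼ` of the induced metric. -/
def christoffel (X : Euc n → Euc (n + 1)) (k i j : Fin n) (x : Euc n) : ℝ :=
  (1 / 2) * ∑ l, (metric X x)⁻¹ k l *
    (pd i (fun y => metric X y j l) x + pd j (fun y => metric X y i l) x
      - pd l (fun y => metric X y i j) x)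

/-- The Hessian `∇²ᵢⱼ f` of a function with respect to the induced metric. -/
def hessian (X : Euc n → Euc (n + 1)) (f : Euc n → ℝ) (i j : Fin n) (x : Euc n) : ℝ :=
  pd i (pd j f) x - ∑ k, christoffel X k i j x * pd k f x

/-- The covariant derivative `∇ₘ hᵢⱼ` of the second fundamental form. -/
def covSecondForm (X N : Euc n → Euc (n + 1)) (m i j : Fin n) (x : Euc n) : ℝ :=
  pd m (fun y => secondForm X N y i j) x
    - ∑ k, christoffel X k m i x * secondForm X N x k j
    - ∑ k, christoffel X k m j x * secondForm X N x i k

/-- The tensor `Pᵢⱼ = ∇²ᵢⱼ K^α - bᵐˡ ∇ₘhᵢⱼ ∇ₗK^α + K^α hᵏᵢ hₖⱼ`. -/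
def chowTensor (α : ℝ) (X N : Euc n → Euc (n + 1)) (i j : Fin n) (x : Euc n) : ℝ :=
  hessian X (speed α X N) i j x
    - ∑ m, ∑ l, invSecondForm X N x m l * covSecondForm X N m i j x * pd l (speed α X N) x
    + speed α X N x *
      ∑ k, ∑ l, (metric X x)⁻¹ k l * secondForm X N x l i * secondForm X N x k j

/-- The quantity `P = (∂ₜK^α - bⁱʲ ∇ᵢK^α ∇ⱼK^α) / (α K^α)` of a family of parametrizations
`X s`, with unit normals `N s`, over the time set `J`. -/
def chowScalar (α : ℝ) (J : Set ℝ) (X N : ℝ → Euc n → Euc (n + 1)) (t : ℝ) (x : Euc n) : ℝ :=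
  1 / (α * speed α (X t) (N t) x) *
    (derivWithin (fun s => speed α (X s) (N s) x) J t
      - ∑ i, ∑ j, invSecondForm (X t) (N t) x i j *
          pd i (speed α (X t) (N t)) x * pd j (speed α (X t) (N t)) x)

/-- The vector `T = bⁱʲ ∇ᵢK^α ∇ⱼX + K^α N`. -/
def translationVector (α : ℝ) (X N : Euc n → Euc (n + 1)) (x : Euc n) : Euc (n + 1) :=
  (∑ i, ∑ j, (invSecondForm X N x i j * pd i (speed α X N) x) • pd j X x)
    + speed α X N x • N x

end Coordinates

/-! ### Flows of hypersurfaces parametrized by a manifold -/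

section Flow

variable {n : ℕ} {M : Type*} [TopologicalSpace M] [ChartedSpace (Euc n) M]

/-- The smooth charts of `M`. -/
def charts (n : ℕ) (M : Type*) [TopologicalSpace M] [ChartedSpace (Euc n) M] :
    Set (OpenPartialHomeomorph M (Euc n)) :=
  IsManifold.maximalAtlas (𝓡 n) ∞ M

/-- The time-dependent map `F : M × ℝ → ℝⁿ⁺¹` read in the chart `φ`. -/
def inChart (φ : OpenPartialHomeomorph M (Euc n)) (F : M → ℝ → Euc (n + 1)) (t : ℝ) (x : Euc n) :
    Euc (n + 1) :=
  F (φ.symm x) t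

/-- `F : M × J → ℝⁿ⁺¹` is a smooth family of strictly convex immersions and `ν` is its unit normal
field pointing away from the convex side, i.e. the one whose second fundamental form is positive
definite. -/
structure IsStrictlyConvexFamily (J : Set ℝ) (F ν : M → ℝ → Euc (n + 1)) : Prop where
  smooth : ContMDiffOn ((𝓡 n).prod 𝓘(ℝ, ℝ)) 𝓘(ℝ, Euc (n + 1)) ∞
    (fun q : M × ℝ => F q.1 q.2) (univ ×ˢ J)
  smooth_normal : ContMDiffOn ((𝓡 n).prod 𝓘(ℝ, ℝ)) 𝓘(ℝ, Euc (n + 1)) ∞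
    (fun q : M × ℝ => ν q.1 q.2) (univ ×ˢ J)
  immersion : ∀ φ ∈ charts n M, ∀ x ∈ φ.target, ∀ t ∈ J,
    LinearIndependent ℝ (fun i : Fin n => pd i (inChart φ F t) x)
  unit : ∀ p, ∀ t ∈ J, ‖ν p t‖ = 1
  normal : ∀ φ ∈ charts n M, ∀ x ∈ φ.target, ∀ t ∈ J, ∀ i : Fin n,
    inner ℝ (pd i (inChart φ F t) x) (inChart φ ν t x) = 0
  convex : ∀ φ ∈ charts n M, ∀ x ∈ φ.target, ∀ t ∈ J,
    (secondForm (inChart φ F t) (inChart φ ν t) x).PosDef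

/-- `F` is a smooth strictly convex solution of the `α`-Gauss curvature flow
`∂ₜF = -K^α ν` over the time set `J`. -/
structure IsGaussCurvatureFlow (α : ℝ) (J : Set ℝ) (F ν : M → ℝ → Euc (n + 1)) : Prop
    extends IsStrictlyConvexFamily J F ν where
  flow : ∀ φ ∈ charts n M, ∀ x ∈ φ.target, ∀ t ∈ J,
    derivWithin (fun s => F (φ.symm x) s) J t =
      -(speed α (inChart φ F t) (inChart φ ν t) x • inChart φ ν t x)

/-- The immersed hypersurface `f : M → ℝⁿ⁺¹` with unit normal `ν` is a translating soliton of the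
`α`-Gauss curvature flow with velocity `V`: its translates `f + tV`, `t ∈ ℝ`, are strictly convex
hypersurfaces that solve the flow as moving hypersurfaces (that is, up to tangential
reparametrization): the normal component of their velocity is `-K^α`. The hypersurface need not be
complete. -/
structure IsTranslatingSoliton (α : ℝ) (f ν : M → Euc (n + 1)) (V : Euc (n + 1)) : Prop where
  convex : IsStrictlyConvexFamily (n := n) (univ : Set ℝ) (fun p t => f p + t • V) (fun p _ => ν p)
  flow : ∀ φ ∈ charts n M, ∀ x ∈ φ.target, ∀ t : ℝ,
    inner ℝ (deriv (fun s : ℝ => f (φ.symm x) + s • V) t) (ν (φ.symm x)) =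
      -speed α (inChart φ (fun p s => f p + s • V) t) (inChart φ (fun p _ => ν p) t) x

end Flow

end GCF

end

/-!
The quantity `P` is, up to the factor `αK^α`, the time derivative of the speed `u = K^α` at a fixed
normal direction. Writing `D = ∂ₜ - bⁱʲ ∇ᵢu ∂ⱼ`, the flow gives `DN = 0`, `DX = -T` and
`Du = αuP = 0`. The vector `T` is characterized by `⟨T, N⟩ = u` and `⟨T, ∂ᵢN⟩ = ∂ᵢu`, in other words
`T` is the ambient gradient of `u` as a 1-homogeneous function of the normal. Hence `DT = 0`, and by
the Codazzi equation `Pᵢⱼ = ⟨∂ᵢT, ∂ⱼN⟩` (`IsConvexPatch.chowTensor_eq_inner`).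

The curvature is `K = det C / det H` with `C = ⟨∂ᵢN, ∂ⱼN⟩` and `H = ⟨∂ᵢX, ∂ⱼN⟩`. In a frame that is
transported by `D`, the matrices `C` and `P` are constant and `H` decreases linearly with rate `P`,
while `K` is constant. So `det (H - sP)` is constant in `s`; its first two derivatives give
`tr (H⁻¹P) = 0` and `tr (H⁻¹PH⁻¹P) = 0`, and since `H` is positive definite, `P = 0`. The proof works
in the given coordinates, where the commutator of `D` and `∂ᵢ` contributes terms with the matrix
`A = ∂w` that drop out of the traces: `eq_zero_of_det_ratio_const` is the matrix argument and
`fderiv_translation_eq_zero` the geometric one.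

It follows that `T` is locally constant at interior times (`fderiv_translationVector_eq_zero`), and by
continuity up to the end points. As `T` does not depend on the coordinates
(`translationVector_comp`), it is constant on the connected manifold, and `⟨T, ν⟩ = K^α` says that the
hypersurface translates with velocity `-T`.
-/

noncomputable section

namespace GCF

/-! ### Frames along a hypersurface and their Gram matrices -/

section Frame

variable {n : ℕ} {v : Fin n → Euc (n + 1)} {N : Euc (n + 1)}

/-- A tangent frame of a hypersurface and a unit normal together span the ambient space. -/
lemma eq_zero_of_inner_frame_eq_zero (hv : LinearIndependent ℝ v) (hN : ‖N‖ = 1)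
    (hvN : ∀ i, inner ℝ (v i) N = 0) {w : Euc (n + 1)} (hw : ∀ i, inner ℝ w (v i) = 0)
    (hwN : inner ℝ w N = 0) : w = 0 := by
  have hspan : ∀ y ∈ Submodule.span ℝ (range v), inner ℝ y N = 0 := by
    intro y hy
    induction hy using Submodule.span_induction with
    | mem x hx => obtain ⟨i, rfl⟩ := hx; exact hvN i
    | zero => simp
    | add x y _ _ hx hy => rw [inner_add_left, hx, hy, add_zero]
    | smul a x _ hx => rw [real_inner_smul_left, hx, mul_zero]
  have hNspan : N ∉ Submodule.span ℝ (range v) := by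
    intro h
    have := hspan N h
    rw [real_inner_self_eq_norm_sq, hN] at this
    norm_num at this
  have hli : LinearIndependent ℝ (Fin.cons N v : Fin (n + 1) → Euc (n + 1)) :=
    linearIndependent_finCons.2 ⟨hv, hNspan⟩
  refine InnerProductSpace.ext_inner_right_basis (𝕜 := ℝ)
    (basisOfLinearIndependentOfCardEqFinrank hli (by simp)) fun i => ?_
  rw [coe_basisOfLinearIndependentOfCardEqFinrank, inner_zero_left]
  refine Fin.cases ?_ (fun j => ?_) i
  · simpa using hwN
  · simpa using hw j

lemma det_gram_pos (hv : LinearIndependent ℝ v) : 0 < (Matrix.gram ℝ v).det :=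
  (Matrix.posDef_gram_of_linearIndependent hv).det_pos

/-- A tangent vector expanded in a tangent frame by means of the inverse metric. -/
lemma eq_sum_inv_gram_smul (hv : LinearIndependent ℝ v) (hN : ‖N‖ = 1)
    (hvN : ∀ i, inner ℝ (v i) N = 0) {w : Euc (n + 1)} (hwN : inner ℝ w N = 0) :
    w = ∑ k, (∑ l, (Matrix.gram ℝ v)⁻¹ k l * inner ℝ w (v l)) • v k := by
  rw [← sub_eq_zero]
  refine eq_zero_of_inner_frame_eq_zero hv hN hvN (fun i => ?_) ?_
  · have h1 : Matrix.gram ℝ v * (Matrix.gram ℝ v)⁻¹ = 1 :=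
      Matrix.mul_nonsing_inv _ (det_gram_pos hv).ne'.isUnit
    have h2 : (Matrix.gram ℝ v *ᵥ ((Matrix.gram ℝ v)⁻¹ *ᵥ fun l => inner ℝ w (v l))) i
        = inner ℝ w (v i) := by
      rw [Matrix.mulVec_mulVec, h1, Matrix.one_mulVec]
    rw [inner_sub_left, sum_inner, ← h2, sub_eq_zero]
    simp only [Matrix.mulVec, dotProduct, Matrix.gram_apply, real_inner_smul_left]
    refine Finset.sum_congr rfl fun k _ => ?_
    rw [mul_comm, real_inner_comm]
  · rw [inner_sub_left, sum_inner, hwN]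
    simp [real_inner_smul_left, hvN]

lemma inner_eq_sum_inv_gram (hv : LinearIndependent ℝ v) (hN : ‖N‖ = 1)
    (hvN : ∀ i, inner ℝ (v i) N = 0) {w : Euc (n + 1)} (hwN : inner ℝ w N = 0)
    (w' : Euc (n + 1)) :
    inner ℝ w w' = ∑ k, ∑ l, (Matrix.gram ℝ v)⁻¹ k l * inner ℝ w (v l) * inner ℝ (v k) w' := by
  conv_lhs => rw [eq_sum_inv_gram_smul hv hN hvN hwN]
  rw [sum_inner]
  refine Finset.sum_congr rfl fun k _ => ?_
  rw [real_inner_smul_left, Finset.sum_mul]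

/-- Tangent vectors whose pairing with a tangent frame is nondegenerate form a frame as well. -/
lemma linearIndependent_of_det_pairing_ne_zero {v' : Fin n → Euc (n + 1)}
    (h : (Matrix.of fun i j => (inner ℝ (v i) (v' j) : ℝ)).det ≠ 0) : LinearIndependent ℝ v' := by
  rw [Fintype.linearIndependent_iff]
  intro c hc
  have : (Matrix.of fun i j => (inner ℝ (v i) (v' j) : ℝ)) *ᵥ c = 0 := by
    ext i
    have h0 : inner ℝ (v i) (∑ j, c j • v' j) = 0 := by rw [hc, inner_zero_right]
    rw [inner_sum] at h0
    simpa [Matrix.mulVec, dotProduct, real_inner_smul_right, mul_comm] using h0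
  exact fun i => congrFun (Matrix.eq_zero_of_mulVec_eq_zero h this) i

end Frame

/-! ### Derivatives of matrix-valued functions -/

section MatrixCalculus

variable {ι : Type*} [Fintype ι] {Z : Type*} [NormedAddCommGroup Z] [NormedSpace ℝ Z]

/-- The entrywise derivative of a matrix-valued function at `z` in the direction `v`. -/
def matDeriv (M : Z → Matrix ι ι ℝ) (z v : Z) : Matrix ι ι ℝ :=
  Matrix.of fun i j => fderiv ℝ (fun y => M y i j) z v

lemma matDeriv_mul {M M' : Z → Matrix ι ι ℝ} {z : Z}
    (hM : ∀ i j, DifferentiableAt ℝ (fun y => M y i j) z)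
    (hM' : ∀ i j, DifferentiableAt ℝ (fun y => M' y i j) z) (v : Z) :
    matDeriv (fun y => M y * M' y) z v = matDeriv M z v * M' z + M z * matDeriv M' z v := by
  ext i j
  simp only [matDeriv, Matrix.of_apply, Matrix.add_apply, Matrix.mul_apply]
  rw [fderiv_fun_sum fun k _ => (hM i k).fun_mul (hM' k j), sum_apply,
    ← Finset.sum_add_distrib]
  refine Finset.sum_congr rfl fun k _ => ?_
  rw [fderiv_fun_mul (hM i k) (hM' k j)]
  simp
  ring

variable [DecidableEq ι]

/-- Jacobi's formula for the derivative of a determinant. -/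
lemma hasFDerivAt_det {M : Z → Matrix ι ι ℝ} {z : Z}
    (hM : ∀ i j, DifferentiableAt ℝ (fun y => M y i j) z) :
    HasFDerivAt (fun y => (M y).det)
      (∑ i, ∑ j, (M z).adjugate j i • fderiv ℝ (fun y => M y i j) z) z := by
  let d : ContinuousMultilinearMap ℝ (fun _ : ι => ι → ℝ) ℝ :=
    ⟨(Matrix.detRowAlternating (R := ℝ) (n := ι)).toMultilinearMap,
      Continuous.matrix_det (A := fun A : ι → ι → ℝ => (A : Matrix ι ι ℝ)) continuous_id⟩
  have h1 : HasFDerivAt (fun y => (fun i j => M y i j : ι → ι → ℝ))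
      (ContinuousLinearMap.pi fun i => ContinuousLinearMap.pi fun j =>
        fderiv ℝ (fun y => M y i j) z) z :=
    hasFDerivAt_pi.2 fun i => hasFDerivAt_pi.2 fun j => (hM i j).hasFDerivAt
  have h2 := (d.hasFDerivAt (fun i j => M z i j)).comp z h1
  refine HasFDerivAt.congr_fderiv (f' := _) h2 ?_
  ext v
  simp only [ContinuousLinearMap.comp_apply, ContinuousMultilinearMap.linearDeriv_apply,
    sum_apply, smul_apply, smul_eq_mul]
  refine Finset.sum_congr rfl fun i _ => ?_
  have h3 : d (Function.update (fun i j => M z i j) i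
      (fun j => fderiv ℝ (fun y => M y i j) z v)) =
      ((M z)ᵀ.cramer (fun j => fderiv ℝ (fun y => M y i j) z v)) i := by
    rw [Matrix.cramer_transpose_apply]; rfl
  refine h3.trans ?_
  rw [Matrix.cramer_eq_adjugate_mulVec, ← Matrix.adjugate_transpose]
  simp [Matrix.mulVec, dotProduct]

lemma differentiableAt_det {M : Z → Matrix ι ι ℝ} {z : Z}
    (hM : ∀ i j, DifferentiableAt ℝ (fun y => M y i j) z) :
    DifferentiableAt ℝ (fun y => (M y).det) z :=
  (hasFDerivAt_det hM).differentiableAt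

lemma fderiv_det_apply {M : Z → Matrix ι ι ℝ} {z : Z}
    (hM : ∀ i j, DifferentiableAt ℝ (fun y => M y i j) z) (v : Z) :
    fderiv ℝ (fun y => (M y).det) z v = ((M z).adjugate * matDeriv M z v).trace := by
  rw [(hasFDerivAt_det hM).fderiv, Matrix.trace]
  simp only [sum_apply, smul_apply, smul_eq_mul,
    Matrix.diag_apply, Matrix.mul_apply, matDeriv, Matrix.of_apply]
  exact Finset.sum_comm

lemma inv_apply_eq (A : Matrix ι ι ℝ) (i j : ι) :
    A⁻¹ i j = (A.det)⁻¹ * (A.updateRow j (Pi.single i 1)).det := by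
  rw [Matrix.inv_def, Matrix.smul_apply, Matrix.adjugate_apply, Ring.inverse_eq_inv', smul_eq_mul]

lemma differentiableAt_inv {M : Z → Matrix ι ι ℝ} {z : Z}
    (hM : ∀ i j, DifferentiableAt ℝ (fun y => M y i j) z) (h0 : (M z).det ≠ 0) (i j : ι) :
    DifferentiableAt ℝ (fun y => (M y)⁻¹ i j) z := by
  simp only [inv_apply_eq]
  refine ((differentiableAt_det hM).inv h0).mul (differentiableAt_det fun k l => ?_)
  by_cases hk : k = j
  · subst hk; simp
  · simpa [Matrix.updateRow_ne hk] using hM k l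

lemma contDiffOn_det {M : Z → Matrix ι ι ℝ} {s : Set Z} {m : WithTop ℕ∞}
    (hM : ∀ i j, ContDiffOn ℝ m (fun y => M y i j) s) :
    ContDiffOn ℝ m (fun y => (M y).det) s := by
  simp only [Matrix.det_apply]
  exact ContDiffOn.sum fun σ _ => (contDiffOn_prod fun i _ => hM _ _).const_smul _

lemma contDiffOn_inv {M : Z → Matrix ι ι ℝ} {s : Set Z} {m : WithTop ℕ∞}
    (hM : ∀ i j, ContDiffOn ℝ m (fun y => M y i j) s) (h0 : ∀ z ∈ s, (M z).det ≠ 0) (i j : ι) :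
    ContDiffOn ℝ m (fun y => (M y)⁻¹ i j) s := by
  simp only [inv_apply_eq]
  refine ((contDiffOn_det hM).inv h0).mul (contDiffOn_det fun k l => ?_)
  by_cases hk : k = j
  · subst hk; simpa using contDiffOn_const
  · simpa [Matrix.updateRow_ne hk] using hM k l

lemma matDeriv_inv {M : Z → Matrix ι ι ℝ} {z : Z}
    (hM : ∀ i j, DifferentiableAt ℝ (fun y => M y i j) z) (h0 : (M z).det ≠ 0) (v : Z) :
    matDeriv (fun y => (M y)⁻¹) z v = -((M z)⁻¹ * matDeriv M z v * (M z)⁻¹) := by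
  have hmul := matDeriv_mul hM (differentiableAt_inv hM h0) v
  have hone : matDeriv (fun y => M y * (M y)⁻¹) z v = 0 := by
    have hev : ∀ᶠ y in nhds z, (M y).det ≠ 0 :=
      (differentiableAt_det hM).continuousAt.eventually_ne h0
    ext i j
    have : (fun y => (M y * (M y)⁻¹) i j) =ᶠ[nhds z] fun _ => (1 : Matrix ι ι ℝ) i j :=
      hev.mono fun y hy => by
        change (M y * (M y)⁻¹) i j = _
        rw [Matrix.mul_nonsing_inv _ hy.isUnit]
    simp only [matDeriv, Matrix.of_apply, this.fderiv_eq]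
    simp
  rw [hone] at hmul
  have h1 : M z * matDeriv (fun y => (M y)⁻¹) z v = -(matDeriv M z v * (M z)⁻¹) :=
    eq_neg_of_add_eq_zero_right hmul.symm
  calc matDeriv (fun y => (M y)⁻¹) z v
      = (M z)⁻¹ * (M z * matDeriv (fun y => (M y)⁻¹) z v) := by
        rw [← Matrix.mul_assoc, Matrix.nonsing_inv_mul _ h0.isUnit, Matrix.one_mul]
    _ = _ := by rw [h1, Matrix.mul_neg, Matrix.mul_assoc]

/-- The squared norm `bⁱᵏ bʲˡ Pᵢⱼ Pₖₗ` of a symmetric `P` in a positive definite metric `b` vanishes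
only for `P = 0`. -/
lemma eq_zero_of_trace_mul_mul_mul_eq_zero {b P : Matrix ι ι ℝ} (hb : b.PosDef) (hP : Pᵀ = P)
    (h : (b * P * b * P).trace = 0) : P = 0 := by
  open scoped MatrixOrder in
  obtain ⟨B, hB⟩ := CStarAlgebra.nonneg_iff_eq_star_mul_self.mp hb.posSemidef.nonneg
  rw [Matrix.star_eq_conjTranspose, Matrix.conjTranspose_eq_transpose_of_trivial] at hB
  have hBdet : IsUnit B.det := by
    have h1 := hb.det_pos
    rw [hB, Matrix.det_mul, Matrix.det_transpose] at h1
    exact (mul_self_pos.1 h1).isUnit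
  have hS : (B * P * Bᵀ)ᴴ = B * P * Bᵀ := by
    rw [Matrix.conjTranspose_eq_transpose_of_trivial, Matrix.transpose_mul, Matrix.transpose_mul,
      Matrix.transpose_transpose, hP, Matrix.mul_assoc]
  have hS0 : B * P * Bᵀ = 0 := by
    rw [← Matrix.trace_conjTranspose_mul_self_eq_zero_iff, hS]
    calc (B * P * Bᵀ * (B * P * Bᵀ)).trace = (Bᵀ * (B * P * Bᵀ * (B * P))).trace := by
          rw [Matrix.trace_mul_comm Bᵀ]; simp only [Matrix.mul_assoc]
      _ = 0 := by rw [← h, hB]; simp only [Matrix.mul_assoc]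
  have hBt : IsUnit (Bᵀ).det := by rwa [Matrix.det_transpose]
  calc P = B⁻¹ * (B * P * Bᵀ) * (Bᵀ)⁻¹ := by
        rw [Matrix.mul_assoc, Matrix.mul_assoc, Matrix.mul_assoc, Matrix.mul_nonsing_inv _ hBt,
          Matrix.mul_one, ← Matrix.mul_assoc, Matrix.nonsing_inv_mul _ hBdet, Matrix.one_mul]
    _ = 0 := by rw [hS0, Matrix.mul_zero, Matrix.zero_mul]

/-- Let `H`, `C`, `P` be matrix fields with `∂H = -P + AH + HAᵀ`, `∂C = AC + CAᵀ` and
`∂P = AP + PAᵀ` along a vector field `V`. If the ratio `det C / det H` is constant along `V`, then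
`tr (H⁻¹P)` vanishes, and differentiating once more, so does `tr (H⁻¹PH⁻¹P)`; hence `P = 0`. -/
lemma eq_zero_of_det_ratio_const {Ω : Set Z} (hΩ : IsOpen Ω) {H C P A : Z → Matrix ι ι ℝ}
    {V : Z → Z} {K : Z → ℝ}
    (hHd : ∀ z ∈ Ω, ∀ i j, DifferentiableAt ℝ (fun y => H y i j) z)
    (hCd : ∀ z ∈ Ω, ∀ i j, DifferentiableAt ℝ (fun y => C y i j) z)
    (hPd : ∀ z ∈ Ω, ∀ i j, DifferentiableAt ℝ (fun y => P y i j) z)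
    (hKd : ∀ z ∈ Ω, DifferentiableAt ℝ K z)
    (hH : ∀ z ∈ Ω, matDeriv H z (V z) = -P z + A z * H z + H z * (A z)ᵀ)
    (hC : ∀ z ∈ Ω, matDeriv C z (V z) = A z * C z + C z * (A z)ᵀ)
    (hP : ∀ z ∈ Ω, matDeriv P z (V z) = A z * P z + P z * (A z)ᵀ)
    (hKH : ∀ z ∈ Ω, (C z).det = K z * (H z).det) (hK : ∀ z ∈ Ω, fderiv ℝ K z (V z) = 0)
    (hK0 : ∀ z ∈ Ω, K z ≠ 0) (hpos : ∀ z ∈ Ω, (H z).PosDef) (hsymm : ∀ z ∈ Ω, (P z)ᵀ = P z) :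
    ∀ z ∈ Ω, P z = 0 := by
  have hdet : ∀ z ∈ Ω, (H z).det ≠ 0 := fun z hz => (hpos z hz).det_pos.ne'
  have conj_trace : ∀ Q B : Matrix ι ι ℝ,
      (Q.adjugate * (B * Q + Q * Bᵀ)).trace = 2 * (Q.det * B.trace) := by
    intro Q B
    rw [Matrix.mul_add, Matrix.trace_add, Matrix.trace_mul_comm, Matrix.mul_assoc,
      Matrix.mul_adjugate, ← Matrix.mul_assoc, Matrix.adjugate_mul]
    simp [Matrix.trace_transpose]
    ring
  -- differentiating `det C = K det H`, the contributions of `A` to both sides cancel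
  have htr : ∀ z ∈ Ω, ((H z)⁻¹ * P z).trace = 0 := by
    intro z hz
    have h1 : fderiv ℝ (fun y => (C y).det) z (V z)
        = fderiv ℝ (fun y => K y * (H y).det) z (V z) := by
      rw [Filter.EventuallyEq.fderiv_eq]
      filter_upwards [hΩ.mem_nhds hz] with y hy using hKH y hy
    have h2 : fderiv ℝ (fun y => K y * (H y).det) z (V z)
        = K z * fderiv ℝ (fun y => (H y).det) z (V z) := by
      rw [fderiv_fun_mul (hKd z hz) (differentiableAt_det (hHd z hz))]
      simp [hK z hz]
    have h3 : (H z).adjugate = (H z).det • (H z)⁻¹ := by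
      rw [Matrix.inv_def, Ring.inverse_eq_inv', smul_smul, mul_inv_cancel₀ (hdet z hz), one_smul]
    rw [h2, fderiv_det_apply (hCd z hz), fderiv_det_apply (hHd z hz), hC z hz, hH z hz,
      conj_trace, add_assoc, Matrix.mul_add, Matrix.trace_add, conj_trace, hKH z hz,
      Matrix.mul_neg, Matrix.trace_neg, h3, Matrix.smul_mul, Matrix.trace_smul, smul_eq_mul] at h1
    have h4 : K z * (H z).det * ((H z)⁻¹ * P z).trace = 0 := by linarith
    exact (mul_eq_zero.1 h4).resolve_left (mul_ne_zero (hK0 z hz) (hdet z hz))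
  intro z hz
  refine eq_zero_of_trace_mul_mul_mul_eq_zero (hpos z hz).inv (hsymm z hz) ?_
  have hid := differentiableAt_inv (hHd z hz) (hdet z hz)
  have h1 : (matDeriv (fun y => (H y)⁻¹ * P y) z (V z)).trace = 0 := by
    have : fderiv ℝ (fun y => ((H y)⁻¹ * P y).trace) z (V z) = 0 := by
      have h0 : (fun y => ((H y)⁻¹ * P y).trace) =ᶠ[nhds z] fun _ => 0 := by
        filter_upwards [hΩ.mem_nhds hz] with y hy using htr y hy
      rw [h0.fderiv_eq]
      simp
    rw [← this]
    simp only [Matrix.trace, Matrix.diag_apply, matDeriv, Matrix.of_apply]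
    rw [fderiv_fun_sum, sum_apply]
    intro i _
    simp only [Matrix.mul_apply]
    exact DifferentiableAt.fun_sum fun j _ => (hid i j).mul (hPd z hz j i)
  rw [matDeriv_mul hid (hPd z hz), matDeriv_inv (hHd z hz) (hdet z hz), hH z hz, hP z hz] at h1
  have hHH : (H z)⁻¹ * H z = 1 := Matrix.nonsing_inv_mul _ (hdet z hz).isUnit
  have hHH' : H z * (H z)⁻¹ = 1 := Matrix.mul_nonsing_inv _ (hdet z hz).isUnit
  generalize H z = h, (H z)⁻¹ = b, P z = p, A z = a at *
  -- the terms with `a` form a commutator, which has no trace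
  have e1 : -(b * (-p + a * h + h * aᵀ) * b) = b * p * b - b * a - aᵀ * b := by
    calc -(b * (-p + a * h + h * aᵀ) * b)
        = b * p * b - b * a * (h * b) - (b * h) * aᵀ * b := by noncomm_ring
      _ = _ := by rw [hHH, hHH', Matrix.mul_one, Matrix.one_mul]
  rw [e1] at h1
  have e2 : (b * p * b - b * a - aᵀ * b) * p + b * (a * p + p * aᵀ)
      = b * p * b * p + (b * p * aᵀ - aᵀ * (b * p)) := by noncomm_ring
  rw [e2, Matrix.trace_add, Matrix.trace_sub, Matrix.trace_mul_comm aᵀ, sub_self, add_zero] at h1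
  exact h1

end MatrixCalculus

/-! ### Transport of a hypersurface with fixed normals -/

section Transport

variable {ι : Type*} {Z : Type*} [NormedAddCommGroup Z] [NormedSpace ℝ Z]
  {E : Type*} [NormedAddCommGroup E] [InnerProductSpace ℝ E]

/-- The matrix `⟨∂ᵢa, ∂ⱼb⟩` of two vector-valued functions, `∂ᵢ` being the derivative in the constant
direction `e i`. -/
def pairing (e : ι → Z) (a b : Z → E) (z : Z) : Matrix ι ι ℝ :=
  Matrix.of fun i j => inner ℝ (fderiv ℝ a z (e i)) (fderiv ℝ b z (e j))

lemma contDiffOn_fderiv_apply {F : Type*} [NormedAddCommGroup F] [NormedSpace ℝ F] {Ω : Set Z}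
    (hΩ : IsOpen Ω) {f : Z → F} (hf : ContDiffOn ℝ ∞ f Ω) (v : Z) :
    ContDiffOn ℝ ∞ (fun y => fderiv ℝ f y v) Ω :=
  (hf.fderiv_of_isOpen hΩ (by simp)).clm_apply contDiffOn_const

lemma differentiableAt_of_contDiffOn {F : Type*} [NormedAddCommGroup F] [NormedSpace ℝ F]
    {Ω : Set Z} (hΩ : IsOpen Ω) {f : Z → F} (hf : ContDiffOn ℝ ∞ f Ω) {z : Z} (hz : z ∈ Ω) :
    DifferentiableAt ℝ f z :=
  (hf.contDiffAt (hΩ.mem_nhds hz)).differentiableAt (by simp)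

lemma fderiv_fderiv_comm {F : Type*} [NormedAddCommGroup F] [NormedSpace ℝ F] {Ω : Set Z}
    (hΩ : IsOpen Ω) {f : Z → F} (hf : ContDiffOn ℝ ∞ f Ω) {z : Z} (hz : z ∈ Ω) (v w : Z) :
    fderiv ℝ (fun y => fderiv ℝ f y v) z w = fderiv ℝ (fun y => fderiv ℝ f y w) z v := by
  have hd : DifferentiableAt ℝ (fderiv ℝ f) z :=
    differentiableAt_of_contDiffOn hΩ (hf.fderiv_of_isOpen hΩ (by simp)) hz
  have hs : IsSymmSndFDerivAt ℝ f z :=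
    (hf.contDiffAt (hΩ.mem_nhds hz)).isSymmSndFDerivAt
      (by rw [minSmoothness_of_isRCLikeNormedField]; exact WithTop.coe_le_coe.2 le_top)
  rw [fderiv_clm_apply hd (differentiableAt_const v),
    fderiv_clm_apply hd (differentiableAt_const w)]
  simp [hs.eq v w]

/-- The commutator of the derivative along a vector field `V` with a constant direction. -/
lemma fderiv_fderiv_along {F : Type*} [NormedAddCommGroup F] [NormedSpace ℝ F] {Ω : Set Z}
    (hΩ : IsOpen Ω) {f : Z → F} (hf : ContDiffOn ℝ ∞ f Ω) {V : Z → Z} (hV : ContDiffOn ℝ ∞ V Ω)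
    {z : Z} (hz : z ∈ Ω) (v : Z) :
    fderiv ℝ (fun y => fderiv ℝ f y v) z (V z)
      = fderiv ℝ (fun y => fderiv ℝ f y (V y)) z v - fderiv ℝ f z (fderiv ℝ V z v) := by
  have hd : DifferentiableAt ℝ (fderiv ℝ f) z :=
    differentiableAt_of_contDiffOn hΩ (hf.fderiv_of_isOpen hΩ (by simp)) hz
  have hs : IsSymmSndFDerivAt ℝ f z :=
    (hf.contDiffAt (hΩ.mem_nhds hz)).isSymmSndFDerivAt
      (by rw [minSmoothness_of_isRCLikeNormedField]; exact WithTop.coe_le_coe.2 le_top)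
  rw [fderiv_clm_apply hd (differentiableAt_const v),
    fderiv_clm_apply hd (differentiableAt_of_contDiffOn hΩ hV hz)]
  simp [hs.eq v (V z)]

lemma contDiffOn_pairing {Ω : Set Z} (hΩ : IsOpen Ω) (e : ι → Z) {a b : Z → E}
    (ha : ContDiffOn ℝ ∞ a Ω) (hb : ContDiffOn ℝ ∞ b Ω) (i j : ι) :
    ContDiffOn ℝ ∞ (fun y => pairing e a b y i j) Ω :=
  (contDiffOn_fderiv_apply hΩ ha (e i)).inner ℝ (contDiffOn_fderiv_apply hΩ hb (e j))

variable [Fintype ι]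

/-- The commutator when the coordinate derivatives of `V` stay in the span of the directions
`e`, for functions with prescribed derivative along `V`. -/
lemma fderiv_fderiv_along_of_eq {F : Type*} [NormedAddCommGroup F] [NormedSpace ℝ F]
    {Ω : Set Z} (hΩ : IsOpen Ω) {f f' : Z → F} (hf : ContDiffOn ℝ ∞ f Ω) {V : Z → Z}
    (hV : ContDiffOn ℝ ∞ V Ω) (hf' : ∀ z ∈ Ω, fderiv ℝ f z (V z) = f' z) {e : ι → Z}
    {A : Z → Matrix ι ι ℝ} (hA : ∀ z ∈ Ω, ∀ i, fderiv ℝ V z (e i) = -∑ j, A z i j • e j)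
    {z : Z} (hz : z ∈ Ω) (i : ι) :
    fderiv ℝ (fun y => fderiv ℝ f y (e i)) z (V z)
      = fderiv ℝ f' z (e i) + ∑ j, A z i j • fderiv ℝ f z (e j) := by
  have h : (fun y => fderiv ℝ f y (V y)) =ᶠ[nhds z] f' := by
    filter_upwards [hΩ.mem_nhds hz] with y hy using hf' y hy
  rw [fderiv_fderiv_along hΩ hf hV hz, h.fderiv_eq, hA z hz]
  simp [map_sum]

lemma matDeriv_pairing {Ω : Set Z} (hΩ : IsOpen Ω) {a a' b b' : Z → E}
    (ha : ContDiffOn ℝ ∞ a Ω) (hb : ContDiffOn ℝ ∞ b Ω) {V : Z → Z} (hV : ContDiffOn ℝ ∞ V Ω)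
    (ha' : ∀ z ∈ Ω, fderiv ℝ a z (V z) = a' z) (hb' : ∀ z ∈ Ω, fderiv ℝ b z (V z) = b' z)
    {e : ι → Z} {A : Z → Matrix ι ι ℝ}
    (hA : ∀ z ∈ Ω, ∀ i, fderiv ℝ V z (e i) = -∑ j, A z i j • e j) {z : Z} (hz : z ∈ Ω) :
    matDeriv (pairing e a b) z (V z)
      = pairing e a' b z + pairing e a b' z + (A z * pairing e a b z
        + pairing e a b z * (A z)ᵀ) := by
  ext i j
  have h1 := fderiv_inner_apply ℝ
    (differentiableAt_of_contDiffOn hΩ (contDiffOn_fderiv_apply hΩ ha (e i)) hz)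
    (differentiableAt_of_contDiffOn hΩ (contDiffOn_fderiv_apply hΩ hb (e j)) hz) (V z)
  rw [fderiv_fderiv_along_of_eq hΩ ha hV ha' hA hz,
    fderiv_fderiv_along_of_eq hΩ hb hV hb' hA hz] at h1
  simp only [matDeriv, Matrix.of_apply, Matrix.add_apply, Matrix.mul_apply, Matrix.transpose_apply]
  refine h1.trans ?_
  simp only [inner_add_left, inner_add_right, sum_inner, inner_sum, real_inner_smul_left,
    real_inner_smul_right, pairing, Matrix.of_apply]
  simp only [mul_comm]
  ring

variable [DecidableEq ι]

/-- Let a hypersurface `X` with unit normal `N` be transported by a vector field `V` that keeps `N`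
and the speed `u = K^α` fixed and moves `X` by `-T`, where `T` is the vector with `⟨T, N⟩ = u` and
`⟨T, ∂ᵢN⟩ = ∂ᵢu`. Then `T` is kept fixed as well, and the constancy of `K = det⟨∂ᵢN, ∂ⱼN⟩ /
det⟨∂ᵢX, ∂ⱼN⟩` along `V` forces all derivatives of `T` to vanish. -/
theorem fderiv_translation_eq_zero {Ω : Set Z} (hΩ : IsOpen Ω) {X N T : Z → E} {u K : Z → ℝ}
    {V : Z → Z} {e : ι → Z} {A : Z → Matrix ι ι ℝ} {α : ℝ} (hα : α ≠ 0)
    (hX : ContDiffOn ℝ ∞ X Ω) (hN : ContDiffOn ℝ ∞ N Ω) (hT : ContDiffOn ℝ ∞ T Ω)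
    (hu : ContDiffOn ℝ ∞ u Ω) (hV : ContDiffOn ℝ ∞ V Ω)
    (hA : ∀ z ∈ Ω, ∀ i, fderiv ℝ V z (e i) = -∑ j, A z i j • e j)
    (hVX : ∀ z ∈ Ω, fderiv ℝ X z (V z) = -T z) (hVN : ∀ z ∈ Ω, fderiv ℝ N z (V z) = 0)
    (hVu : ∀ z ∈ Ω, fderiv ℝ u z (V z) = 0)
    (hTN : ∀ z ∈ Ω, inner ℝ (T z) (N z) = u z)
    (hTdN : ∀ z ∈ Ω, ∀ i, inner ℝ (T z) (fderiv ℝ N z (e i)) = fderiv ℝ u z (e i))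
    (hframe : ∀ z ∈ Ω, ∀ w : E, (∀ i, inner ℝ w (fderiv ℝ N z (e i)) = 0) →
      inner ℝ w (N z) = 0 → w = 0)
    (hpos : ∀ z ∈ Ω, (pairing e X N z).PosDef) (hKpos : ∀ z ∈ Ω, 0 < K z)
    (hK : ∀ z ∈ Ω, (pairing e N N z).det = K z * (pairing e X N z).det)
    (huK : ∀ z ∈ Ω, u z = K z ^ α) :
    ∀ z ∈ Ω, (∀ i, fderiv ℝ T z (e i) = 0) ∧ fderiv ℝ T z (V z) = 0 := by
  have hdN := fun {z} (hz : z ∈ Ω) => differentiableAt_of_contDiffOn hΩ hN hz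
  have hdT := fun {z} (hz : z ∈ Ω) => differentiableAt_of_contDiffOn hΩ hT hz
  have hddN := fun {z} (hz : z ∈ Ω) i =>
    differentiableAt_of_contDiffOn hΩ (contDiffOn_fderiv_apply hΩ hN (e i)) hz
  have hprod : ∀ z ∈ Ω, ∀ v, inner ℝ (T z) (fderiv ℝ N z v) + inner ℝ (fderiv ℝ T z v) (N z)
      = fderiv ℝ u z v := by
    intro z hz v
    have h : (fun y => inner ℝ (T y) (N y)) =ᶠ[nhds z] u := by
      filter_upwards [hΩ.mem_nhds hz] with y hy using hTN y hy
    rw [← h.fderiv_eq, fderiv_inner_apply ℝ (hdT hz) (hdN hz)]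
  have hprod' : ∀ z ∈ Ω, ∀ i v, inner ℝ (T z) (fderiv ℝ (fun y => fderiv ℝ N y (e i)) z v)
      + inner ℝ (fderiv ℝ T z v) (fderiv ℝ N z (e i))
      = fderiv ℝ (fun y => fderiv ℝ u y (e i)) z v := by
    intro z hz i v
    have h : (fun y => inner ℝ (T y) (fderiv ℝ N y (e i))) =ᶠ[nhds z]
        fun y => fderiv ℝ u y (e i) := by
      filter_upwards [hΩ.mem_nhds hz] with y hy using hTdN y hy i
    rw [← h.fderiv_eq, fderiv_inner_apply ℝ (hdT hz) (hddN hz i)]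
  -- `DT` is orthogonal to `N` and to all `∂ᵢN`, as `D` kills `N` and `u` and has the same
  -- commutator with `∂ᵢ` on `N` and on `u`
  have hVT : ∀ z ∈ Ω, fderiv ℝ T z (V z) = 0 := by
    intro z hz
    refine hframe z hz _ (fun i => ?_) ?_
    · have h := hprod' z hz i (V z)
      rw [fderiv_fderiv_along_of_eq hΩ hN hV hVN hA hz,
        fderiv_fderiv_along_of_eq hΩ hu hV hVu hA hz] at h
      simpa [inner_sum, real_inner_smul_right, hTdN z hz] using h
    · simpa [hVN z hz, hVu z hz] using hprod z hz (V z)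
  -- `K = u ^ (1 / α)` inherits differentiability and constancy along `V` from `u`
  have hKd : ∀ z ∈ Ω, HasFDerivAt K ((α⁻¹ * u z ^ (α⁻¹ - 1)) • fderiv ℝ u z) z := by
    intro z hz
    have hupos : 0 < u z := by rw [huK z hz]; exact Real.rpow_pos_of_pos (hKpos z hz) α
    have h1 := (differentiableAt_of_contDiffOn hΩ hu hz).hasFDerivAt.rpow_const (p := α⁻¹)
      (Or.inl hupos.ne')
    refine h1.congr_of_eventuallyEq ?_
    filter_upwards [hΩ.mem_nhds hz] with y hy
    rw [huK y hy, Real.rpow_rpow_inv (hKpos y hy).le hα]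
  have hsymm : ∀ z ∈ Ω, (pairing e T N z)ᵀ = pairing e T N z := by
    intro z hz
    ext i j
    have h1 := hprod' z hz i (e j)
    have h2 := hprod' z hz j (e i)
    rw [fderiv_fderiv_comm hΩ hu hz, ← h2, fderiv_fderiv_comm hΩ hN hz] at h1
    exact add_left_cancel h1
  have hd := fun {a b : Z → E} (ha : ContDiffOn ℝ ∞ a Ω) (hb : ContDiffOn ℝ ∞ b Ω) z
    (hz : z ∈ Ω) i j => differentiableAt_of_contDiffOn hΩ (contDiffOn_pairing hΩ e ha hb i j) hz
  have hzero_left : ∀ (b : Z → E) z, pairing e (fun _ => (0 : E)) b z = 0 := by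
    intro b z; ext i j; simp [pairing]
  have hzero_right : ∀ (b : Z → E) z, pairing e b (fun _ => (0 : E)) z = 0 := by
    intro b z; ext i j; simp [pairing]
  have hneg : ∀ z, pairing e (fun y => -T y) N z = -pairing e T N z := by
    intro z; ext i j; simp [pairing, fderiv_fun_neg]
  have hPzero := eq_zero_of_det_ratio_const hΩ (H := pairing e X N) (C := pairing e N N)
    (P := pairing e T N) (A := A) (V := V) (K := K) (hd hX hN) (hd hN hN) (hd hT hN)
    (fun z hz => (hKd z hz).differentiableAt)
    (fun z hz => by
      rw [matDeriv_pairing hΩ hX hN hV hVX hVN hA hz, hneg, hzero_right, add_zero, add_assoc])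
    (fun z hz => by
      rw [matDeriv_pairing hΩ hN hN hV hVN hVN hA hz, hzero_left, hzero_right, add_zero, zero_add])
    (fun z hz => by
      rw [matDeriv_pairing hΩ hT hN hV hVT hVN hA hz, hzero_left, hzero_right, add_zero, zero_add])
    hK (fun z hz => by rw [(hKd z hz).fderiv]; simp [hVu z hz]) (fun z hz => (hKpos z hz).ne')
    hpos hsymm
  refine fun z hz => ⟨fun i => hframe z hz _ (fun j => ?_) ?_, hVT z hz⟩
  · exact congrFun (congrFun (hPzero z hz) i) j
  · have h := hprod z hz (e i)
    rw [hTdN z hz] at h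
    simpa using h

end Transport

/-! ### Smoothness of the geometric quantities of a family of parametrizations -/

section Smoothness

variable {n : ℕ} {V : Type*} [NormedAddCommGroup V] [NormedSpace ℝ V] {U : Set (Euc n)} {J : Set ℝ}

/-- Spatial partial derivatives of a family that is smooth up to the boundary of the time set are
smooth up to the boundary, too. -/
lemma contDiffOn_pd (hU : IsOpen U) (hJ : UniqueDiffOn ℝ J) {f : ℝ → Euc n → V}
    (hf : ContDiffOn ℝ ∞ (fun z : Euc n × ℝ => f z.2 z.1) (U ×ˢ J)) (i : Fin n) :
    ContDiffOn ℝ ∞ (fun z : Euc n × ℝ => pd i (f z.2) z.1) (U ×ˢ J) := by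
  have h1 : ContDiffOn ℝ ∞ (fun z => fderivWithin ℝ (fun z : Euc n × ℝ => f z.2 z.1) (U ×ˢ J) z
      (EuclideanSpace.single i (1 : ℝ), (0 : ℝ))) (U ×ˢ J) :=
    (hf.fderivWithin (hU.uniqueDiffOn.prod hJ) (by simp)).clm_apply contDiffOn_const
  refine h1.congr fun z hz => ?_
  have h2 := ((hf z hz).differentiableWithinAt (by simp)).hasFDerivWithinAt
  have h3 : HasFDerivWithinAt (fun y : Euc n => (y, z.2)) (ContinuousLinearMap.inl ℝ (Euc n) ℝ) U
      z.1 := (hasFDerivAt_prodMk_left z.1 z.2).hasFDerivWithinAt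
  have h4 : HasFDerivWithinAt (f z.2) _ U z.1 :=
    HasFDerivWithinAt.comp (g := fun z : Euc n × ℝ => f z.2 z.1) (t := U ×ˢ J) z.1 h2 h3
      fun y hy => mk_mem_prod hy hz.2
  rw [pd, (h4.hasFDerivAt (hU.mem_nhds hz.1)).fderiv]
  rfl

lemma contDiffOn_slice {f : ℝ → Euc n → V}
    (hf : ContDiffOn ℝ ∞ (fun z : Euc n × ℝ => f z.2 z.1) (U ×ˢ J)) {t : ℝ} (ht : t ∈ J) :
    ContDiffOn ℝ ∞ (f t) U :=
  hf.comp (f := fun y : Euc n => (y, t)) (contDiffOn_id.prodMk contDiffOn_const)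
    fun _ hy => ⟨hy, ht⟩

variable {X N : ℝ → Euc n → Euc (n + 1)}

lemma contDiffOn_metric (hU : IsOpen U) (hJ : UniqueDiffOn ℝ J)
    (hX : ContDiffOn ℝ ∞ (fun z : Euc n × ℝ => X z.2 z.1) (U ×ˢ J)) (i j : Fin n) :
    ContDiffOn ℝ ∞ (fun z : Euc n × ℝ => metric (X z.2) z.1 i j) (U ×ˢ J) :=
  (contDiffOn_pd hU hJ hX i).inner ℝ (contDiffOn_pd hU hJ hX j)

lemma contDiffOn_secondForm (hU : IsOpen U) (hJ : UniqueDiffOn ℝ J)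
    (hX : ContDiffOn ℝ ∞ (fun z : Euc n × ℝ => X z.2 z.1) (U ×ˢ J))
    (hN : ContDiffOn ℝ ∞ (fun z : Euc n × ℝ => N z.2 z.1) (U ×ˢ J)) (i j : Fin n) :
    ContDiffOn ℝ ∞ (fun z : Euc n × ℝ => secondForm (X z.2) (N z.2) z.1 i j) (U ×ˢ J) :=
  ((contDiffOn_pd (f := fun s => pd j (X s)) hU hJ (contDiffOn_pd hU hJ hX j) i).inner ℝ hN).neg

end Smoothness

/-! ### A single strictly convex hypersurface in coordinates -/

/-- `X` parametrizes a smooth strictly convex hypersurface over the open set `U`, with unit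
normal `N` pointing away from the convex side. -/
structure IsConvexPatch {n : ℕ} (U : Set (Euc n)) (X N : Euc n → Euc (n + 1)) : Prop where
  isOpen : IsOpen U
  smooth : ContDiffOn ℝ ∞ X U
  smooth_normal : ContDiffOn ℝ ∞ N U
  immersion : ∀ x ∈ U, LinearIndependent ℝ (fun i : Fin n => pd i X x)
  unit : ∀ x ∈ U, ‖N x‖ = 1
  normal : ∀ x ∈ U, ∀ i, inner ℝ (pd i X x) (N x) = 0
  convex : ∀ x ∈ U, (secondForm X N x).PosDef

section PartialDerivatives

variable {n : ℕ} {V : Type*} [NormedAddCommGroup V] [NormedSpace ℝ V] {U : Set (Euc n)}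

lemma pd_congr {f g : Euc n → V} (hU : IsOpen U) (h : ∀ y ∈ U, f y = g y) {x : Euc n} (hx : x ∈ U)
    (i : Fin n) : pd i f x = pd i g x := by
  have : f =ᶠ[nhds x] g := by filter_upwards [hU.mem_nhds hx] with y hy using h y hy
  rw [pd, this.fderiv_eq, pd]

lemma pd_comm {f : Euc n → V} (hU : IsOpen U) (hf : ContDiffOn ℝ ∞ f U) {x : Euc n} (hx : x ∈ U)
    (i j : Fin n) : pd i (pd j f) x = pd j (pd i f) x :=
  fderiv_fderiv_comm hU hf hx _ _

lemma contDiffOn_pd_of_isOpen {f : Euc n → V} (hU : IsOpen U) (hf : ContDiffOn ℝ ∞ f U)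
    (i : Fin n) : ContDiffOn ℝ ∞ (pd i f) U :=
  contDiffOn_fderiv_apply hU hf _

lemma pd_inner {f g : Euc n → Euc (n + 1)} (hU : IsOpen U) (hf : ContDiffOn ℝ ∞ f U)
    (hg : ContDiffOn ℝ ∞ g U) {x : Euc n} (hx : x ∈ U) (i : Fin n) :
    pd i (fun y => (inner ℝ (f y) (g y) : ℝ)) x
      = inner ℝ (f x) (pd i g x) + inner ℝ (pd i f x) (g x) :=
  fderiv_inner_apply ℝ (differentiableAt_of_contDiffOn hU hf hx)
    (differentiableAt_of_contDiffOn hU hg hx) _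

lemma metric_eq_gram (X : Euc n → Euc (n + 1)) (x : Euc n) :
    metric X x = Matrix.gram ℝ (fun i => pd i X x) := rfl

lemma metric_symm (X : Euc n → Euc (n + 1)) (x : Euc n) : (metric X x)ᵀ = metric X x := by
  ext i j; exact real_inner_comm (pd i X x) (pd j X x)

lemma inv_metric_symm (X : Euc n → Euc (n + 1)) (x : Euc n) (i j : Fin n) :
    (metric X x)⁻¹ i j = (metric X x)⁻¹ j i := by
  rw [← Matrix.transpose_apply (metric X x)⁻¹, Matrix.transpose_nonsing_inv, metric_symm]

end PartialDerivatives

namespace IsConvexPatch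

variable {n : ℕ} {U : Set (Euc n)} {X N : Euc n → Euc (n + 1)} {x : Euc n}

lemma secondForm_eq_inner' (h : IsConvexPatch U X N) (hx : x ∈ U) (i j : Fin n) :
    secondForm X N x i j = inner ℝ (pd j X x) (pd i N x) := by
  have h1 := pd_inner h.isOpen (contDiffOn_pd_of_isOpen h.isOpen h.smooth j) h.smooth_normal hx i
  rw [pd_congr h.isOpen (g := fun _ => (0 : ℝ)) (fun y hy => h.normal y hy j) hx i] at h1
  have h0 : pd i (fun _ : Euc n => (0 : ℝ)) x = 0 := by simp [pd]
  rw [h0] at h1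
  change -inner ℝ (pd i (pd j X) x) (N x) = _
  linarith

lemma secondForm_symm (h : IsConvexPatch U X N) (hx : x ∈ U) (i j : Fin n) :
    secondForm X N x i j = secondForm X N x j i := by
  simp only [secondForm, Matrix.of_apply, pd_comm h.isOpen h.smooth hx i j]

/-- The second fundamental form as the pairing of `∂X` and `∂N`. -/
lemma secondForm_eq_inner (h : IsConvexPatch U X N) (hx : x ∈ U) (i j : Fin n) :
    secondForm X N x i j = inner ℝ (pd i X x) (pd j N x) := by
  rw [h.secondForm_symm hx, h.secondForm_eq_inner' hx]

lemma inner_pd_normal_self (h : IsConvexPatch U X N) (hx : x ∈ U) (i : Fin n) :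
    inner ℝ (pd i N x) (N x) = 0 := by
  have h1 := pd_inner h.isOpen h.smooth_normal h.smooth_normal hx i
  rw [pd_congr h.isOpen (g := fun _ => (1 : ℝ))
    (fun y hy => by rw [real_inner_self_eq_norm_sq, h.unit y hy, one_pow]) hx i] at h1
  have h0 : pd i (fun _ : Euc n => (1 : ℝ)) x = 0 := by simp [pd]
  rw [h0, real_inner_comm] at h1
  linarith

lemma det_secondForm_pos (h : IsConvexPatch U X N) (hx : x ∈ U) : 0 < (secondForm X N x).det :=
  (h.convex x hx).det_pos

lemma det_metric_pos (h : IsConvexPatch U X N) (hx : x ∈ U) : 0 < (metric X x).det :=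
  det_gram_pos (h.immersion x hx)

lemma gaussCurvature_pos (h : IsConvexPatch U X N) (hx : x ∈ U) : 0 < gaussCurvature X N x := by
  have h1 := h.det_metric_pos hx
  rw [gaussCurvature, Matrix.det_nonsing_inv, Ring.inverse_eq_inv']
  exact mul_pos (inv_pos.2 h1) (h.det_secondForm_pos hx)

lemma speed_pos (h : IsConvexPatch U X N) (α : ℝ) (hx : x ∈ U) : 0 < speed α X N x :=
  Real.rpow_pos_of_pos (h.gaussCurvature_pos hx) α

/-- The derivatives of the normal of a strictly convex hypersurface form a tangent frame. -/
lemma linearIndependent_pd_normal (h : IsConvexPatch U X N) (hx : x ∈ U) :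
    LinearIndependent ℝ (fun i : Fin n => pd i N x) := by
  refine linearIndependent_of_det_pairing_ne_zero (v := fun i => pd i X x) ?_
  have : (Matrix.of fun i j => (inner ℝ (pd i X x) (pd j N x) : ℝ)) = secondForm X N x := by
    ext i j; exact (h.secondForm_eq_inner hx i j).symm
  rw [this]
  exact (h.det_secondForm_pos hx).ne'

lemma eq_zero_of_inner_pd_normal (h : IsConvexPatch U X N) (hx : x ∈ U) {w : Euc (n + 1)}
    (hw : ∀ i, inner ℝ w (pd i N x) = 0) (hwN : inner ℝ w (N x) = 0) : w = 0 :=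
  eq_zero_of_inner_frame_eq_zero (h.linearIndependent_pd_normal hx) (h.unit x hx)
    (h.inner_pd_normal_self hx) hw hwN

/-- The third fundamental form `⟨∂ᵢN, ∂ⱼN⟩ = hᵏᵢ hₖⱼ`. -/
lemma thirdForm_eq (h : IsConvexPatch U X N) (hx : x ∈ U) (i j : Fin n) :
    inner ℝ (pd i N x) (pd j N x)
      = ∑ k, ∑ l, (metric X x)⁻¹ k l * secondForm X N x l i * secondForm X N x k j := by
  rw [inner_eq_sum_inv_gram (h.immersion x hx) (h.unit x hx) (h.normal x hx)
    (h.inner_pd_normal_self hx i)]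
  refine Finset.sum_congr rfl fun k _ => Finset.sum_congr rfl fun l _ => ?_
  rw [h.secondForm_eq_inner hx l i, h.secondForm_eq_inner hx k j, metric_eq_gram,
    real_inner_comm (pd l X x)]

/-- The Gauss curvature is the ratio of the determinants of the third and the second fundamental
form. -/
lemma det_thirdForm (h : IsConvexPatch U X N) (hx : x ∈ U) :
    (Matrix.of fun i j => (inner ℝ (pd i N x) (pd j N x) : ℝ)).det
      = gaussCurvature X N x * (secondForm X N x).det := by
  have : (Matrix.of fun i j => (inner ℝ (pd i N x) (pd j N x) : ℝ))
      = (secondForm X N x)ᵀ * ((metric X x)⁻¹ * secondForm X N x) := by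
    ext i j
    rw [Matrix.of_apply, h.thirdForm_eq hx]
    simp only [Matrix.mul_apply, Matrix.transpose_apply, Finset.mul_sum]
    rw [Finset.sum_comm]
    refine Finset.sum_congr rfl fun k _ => Finset.sum_congr rfl fun l _ => ?_
    rw [inv_metric_symm X x l k]
    ring
  rw [this, Matrix.det_mul, Matrix.det_mul, Matrix.det_transpose, gaussCurvature]
  ring

lemma invSecondForm_mul (h : IsConvexPatch U X N) (hx : x ∈ U) :
    invSecondForm X N x * secondForm X N x = 1 :=
  Matrix.nonsing_inv_mul _ (h.det_secondForm_pos hx).ne'.isUnit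

lemma sum_invSecondForm_mul (h : IsConvexPatch U X N) (hx : x ∈ U) (i k : Fin n) :
    ∑ j, invSecondForm X N x i j * secondForm X N x j k = if i = k then 1 else 0 := by
  rw [← Matrix.mul_apply, h.invSecondForm_mul hx, Matrix.one_apply]

lemma sum_sum_invSecondForm_mul (h : IsConvexPatch U X N) (hx : x ∈ U) (c : Fin n → ℝ)
    (k : Fin n) :
    ∑ i, ∑ j, invSecondForm X N x i j * c i * secondForm X N x j k = c k := by
  have : ∀ i, ∑ j, invSecondForm X N x i j * c i * secondForm X N x j k
      = c i * if i = k then 1 else 0 := by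
    intro i
    rw [← h.sum_invSecondForm_mul hx, Finset.mul_sum]
    exact Finset.sum_congr rfl fun j _ => by ring
  simp [this]

lemma inner_translationVector (α : ℝ) (X N : Euc n → Euc (n + 1)) (x : Euc n)
    (w : Euc (n + 1)) :
    inner ℝ (translationVector α X N x) w
      = ∑ i, ∑ j, invSecondForm X N x i j * pd i (speed α X N) x * inner ℝ (pd j X x) w
        + speed α X N x * inner ℝ (N x) w := by
  simp only [translationVector, inner_add_left, sum_inner, real_inner_smul_left]

lemma inner_translationVector_normal (h : IsConvexPatch U X N) (α : ℝ) (hx : x ∈ U) :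
    inner ℝ (translationVector α X N x) (N x) = speed α X N x := by
  rw [inner_translationVector, real_inner_self_eq_norm_sq, h.unit x hx]
  simp [h.normal x hx]

/-- The tangential part of `T` is determined by `⟨T, ∂ₖN⟩ = ∂ₖK^α`. -/
lemma inner_translationVector_pd_normal (h : IsConvexPatch U X N) (α : ℝ) (hx : x ∈ U)
    (k : Fin n) :
    inner ℝ (translationVector α X N x) (pd k N x) = pd k (speed α X N) x := by
  rw [inner_translationVector, real_inner_comm, h.inner_pd_normal_self hx, mul_zero, add_zero,
    ← h.sum_sum_invSecondForm_mul hx (fun i => pd i (speed α X N) x) k]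
  simp only [h.secondForm_eq_inner hx]

/-- The Christoffel symbols are the coefficients of the tangential part of `∂ᵢ∂ⱼX`. -/
lemma sum_christoffel_mul_inner (h : IsConvexPatch U X N) (hx : x ∈ U) {w : Euc (n + 1)}
    (hw : inner ℝ w (N x) = 0) (i j : Fin n) :
    ∑ k, christoffel X k i j x * inner ℝ (pd k X x) w = inner ℝ (pd i (pd j X) x) w := by
  have hs := fun i => contDiffOn_pd_of_isOpen h.isOpen h.smooth i
  have hc : ∀ k, christoffel X k i j x
      = ∑ l, (metric X x)⁻¹ k l * inner ℝ (pd i (pd j X) x) (pd l X x) := by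
    intro k
    rw [christoffel, Finset.mul_sum]
    refine Finset.sum_congr rfl fun l _ => ?_
    simp only [metric, Matrix.of_apply]
    rw [pd_inner h.isOpen (hs j) (hs l) hx i, pd_inner h.isOpen (hs i) (hs l) hx j,
      pd_inner h.isOpen (hs i) (hs j) hx l, pd_comm h.isOpen h.smooth hx l j,
      pd_comm h.isOpen h.smooth hx l i, pd_comm h.isOpen h.smooth hx j i,
      real_inner_comm (pd i (pd l X) x)]
    ring
  rw [real_inner_comm, inner_eq_sum_inv_gram (h.immersion x hx) (h.unit x hx) (h.normal x hx) hw,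
    Finset.sum_comm]
  refine Finset.sum_congr rfl fun k _ => ?_
  rw [hc, Finset.sum_mul]
  refine Finset.sum_congr rfl fun l _ => ?_
  rw [inv_metric_symm, metric_eq_gram, real_inner_comm w, real_inner_comm (pd l X x)]
  ring

/-- The Codazzi equation, in the form `⟨∂ₘX, ∂ᵢ∂ⱼN⟩ = ∇ₘhᵢⱼ + Γᵏᵢⱼ hₘₖ`. -/
lemma inner_pd_pd_pd_normal (h : IsConvexPatch U X N) (hx : x ∈ U) (m i j : Fin n) :
    inner ℝ (pd m X x) (pd i (pd j N) x)
      = covSecondForm X N m i j x + ∑ k, christoffel X k i j x * secondForm X N x m k := by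
  have hsX := fun i => contDiffOn_pd_of_isOpen h.isOpen h.smooth i
  have hsN := fun i => contDiffOn_pd_of_isOpen h.isOpen h.smooth_normal i
  have h1 : pd m (fun y => secondForm X N y i j) x
      = inner ℝ (pd i X x) (pd m (pd j N) x) + inner ℝ (pd m (pd i X) x) (pd j N x) := by
    rw [← pd_inner h.isOpen (hsX i) (hsN j) hx m]
    exact pd_congr h.isOpen (fun y hy => h.secondForm_eq_inner hy i j) hx m
  have h2 : ∑ k, christoffel X k m i x * secondForm X N x k j
      = inner ℝ (pd m (pd i X) x) (pd j N x) := by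
    rw [← h.sum_christoffel_mul_inner hx (h.inner_pd_normal_self hx j)]
    simp only [h.secondForm_eq_inner hx]
  have h3 : ∑ k, christoffel X k m j x * secondForm X N x i k
      = inner ℝ (pd m (pd j X) x) (pd i N x) := by
    rw [← h.sum_christoffel_mul_inner hx (h.inner_pd_normal_self hx i)]
    simp only [h.secondForm_eq_inner' hx]
  have h4 : ∑ k, christoffel X k i j x * secondForm X N x m k
      = inner ℝ (pd i (pd j X) x) (pd m N x) := by
    rw [← h.sum_christoffel_mul_inner hx (h.inner_pd_normal_self hx m)]
    simp only [h.secondForm_eq_inner' hx]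
  -- both sides of `∂ⱼhᵢₘ = ∂ⱼhₘᵢ` are expanded by the product rule
  have h5 : inner ℝ (pd i X x) (pd j (pd m N) x) + inner ℝ (pd j (pd i X) x) (pd m N x)
      = inner ℝ (pd m X x) (pd j (pd i N) x) + inner ℝ (pd j (pd m X) x) (pd i N x) := by
    rw [← pd_inner h.isOpen (hsX i) (hsN m) hx j, ← pd_inner h.isOpen (hsX m) (hsN i) hx j]
    refine pd_congr h.isOpen (fun y hy => ?_) hx j
    rw [← h.secondForm_eq_inner hy, ← h.secondForm_eq_inner' hy]
  rw [covSecondForm, h1, h2, h3, h4, pd_comm h.isOpen h.smooth_normal hx i j,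
    pd_comm h.isOpen h.smooth_normal hx m j, pd_comm h.isOpen h.smooth hx i j,
    pd_comm h.isOpen h.smooth hx m j]
  linarith

/-- The tensor `Pᵢⱼ` is the pairing of `∂T` and `∂N`. -/
lemma chowTensor_eq_inner (h : IsConvexPatch U X N) {α : ℝ} (hx : x ∈ U)
    (hT : ContDiffOn ℝ ∞ (translationVector α X N) U) (i j : Fin n) :
    chowTensor α X N i j x = inner ℝ (pd i (translationVector α X N) x) (pd j N x) := by
  have hsN := contDiffOn_pd_of_isOpen h.isOpen h.smooth_normal j
  have h1 : pd i (pd j (speed α X N)) x = inner ℝ (translationVector α X N x) (pd i (pd j N) x)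
      + inner ℝ (pd i (translationVector α X N) x) (pd j N x) := by
    rw [← pd_inner h.isOpen hT hsN hx i]
    exact pd_congr h.isOpen (fun y hy => (h.inner_translationVector_pd_normal α hy j).symm) hx i
  have h2 : inner ℝ (N x) (pd i (pd j N) x) = -inner ℝ (pd i N x) (pd j N x) := by
    have h3 := pd_inner h.isOpen h.smooth_normal hsN hx i
    rw [pd_congr h.isOpen (g := fun _ => (0 : ℝ))
      (fun y hy => by rw [real_inner_comm]; exact h.inner_pd_normal_self hy j) hx i] at h3
    have h0 : pd i (fun _ : Euc n => (0 : ℝ)) x = 0 := by simp [pd]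
    rw [h0] at h3
    linarith
  have h4 : ∑ m, ∑ l, invSecondForm X N x m l * pd m (speed α X N) x
        * ∑ k, christoffel X k i j x * secondForm X N x l k
      = ∑ k, christoffel X k i j x * pd k (speed α X N) x := by
    conv_rhs =>
      enter [2, k]
      rw [← h.sum_sum_invSecondForm_mul hx (fun i => pd i (speed α X N) x) k]
    simp only [Finset.mul_sum]
    rw [Finset.sum_comm]
    conv_rhs => rw [Finset.sum_comm]; enter [2, m]; rw [Finset.sum_comm]
    rw [Finset.sum_comm]
    refine Finset.sum_congr rfl fun m _ => Finset.sum_congr rfl fun l _ =>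
      Finset.sum_congr rfl fun k _ => by ring
  have h5 : ∑ m, ∑ l, invSecondForm X N x m l * pd m (speed α X N) x * covSecondForm X N l i j x
      = ∑ m, ∑ l, invSecondForm X N x m l * covSecondForm X N m i j x * pd l (speed α X N) x := by
    rw [Finset.sum_comm]
    refine Finset.sum_congr rfl fun m _ => Finset.sum_congr rfl fun l _ => ?_
    have hb : invSecondForm X N x l m = invSecondForm X N x m l := by
      have hs : (secondForm X N x)ᵀ = secondForm X N x := by
        ext a b; exact h.secondForm_symm hx b a
      rw [invSecondForm, ← Matrix.transpose_apply (secondForm X N x)⁻¹,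
        Matrix.transpose_nonsing_inv, hs]
    rw [hb]
    ring
  rw [inner_translationVector, h2] at h1
  simp only [h.inner_pd_pd_pd_normal hx, mul_add, Finset.sum_add_distrib] at h1
  rw [h4, h5] at h1
  rw [chowTensor, hessian, ← h.thirdForm_eq hx, h1]
  ring

end IsConvexPatch

/-! ### Families of strictly convex hypersurfaces in coordinates -/

section Family

variable {n : ℕ} {U : Set (Euc n)} {J : Set ℝ} {X N : ℝ → Euc n → Euc (n + 1)}

lemma contDiffOn_speed (hJ : UniqueDiffOn ℝ J)
    (hX : ContDiffOn ℝ ∞ (fun z : Euc n × ℝ => X z.2 z.1) (U ×ˢ J))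
    (hN : ContDiffOn ℝ ∞ (fun z : Euc n × ℝ => N z.2 z.1) (U ×ˢ J)) (hU : IsOpen U)
    (h : ∀ t ∈ J, IsConvexPatch U (X t) (N t)) (α : ℝ) :
    ContDiffOn ℝ ∞ (fun z : Euc n × ℝ => speed α (X z.2) (N z.2) z.1) (U ×ˢ J) := by
  refine ContDiffOn.rpow_const_of_ne (ContDiffOn.mul ?_ ?_) fun z hz =>
    ((h z.2 hz.2).gaussCurvature_pos hz.1).ne'
  · exact contDiffOn_det fun i j => contDiffOn_inv (contDiffOn_metric hU hJ hX)
      (fun z hz => ((h z.2 hz.2).det_metric_pos hz.1).ne') i j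
  · exact contDiffOn_det (contDiffOn_secondForm hU hJ hX hN)

lemma contDiffOn_invSecondForm (hJ : UniqueDiffOn ℝ J)
    (hX : ContDiffOn ℝ ∞ (fun z : Euc n × ℝ => X z.2 z.1) (U ×ˢ J))
    (hN : ContDiffOn ℝ ∞ (fun z : Euc n × ℝ => N z.2 z.1) (U ×ˢ J)) (hU : IsOpen U)
    (h : ∀ t ∈ J, IsConvexPatch U (X t) (N t)) (i j : Fin n) :
    ContDiffOn ℝ ∞ (fun z : Euc n × ℝ => invSecondForm (X z.2) (N z.2) z.1 i j) (U ×ˢ J) :=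
  contDiffOn_inv (contDiffOn_secondForm hU hJ hX hN)
    (fun z hz => ((h z.2 hz.2).det_secondForm_pos hz.1).ne') i j

lemma contDiffOn_translationVector (hJ : UniqueDiffOn ℝ J)
    (hX : ContDiffOn ℝ ∞ (fun z : Euc n × ℝ => X z.2 z.1) (U ×ˢ J))
    (hN : ContDiffOn ℝ ∞ (fun z : Euc n × ℝ => N z.2 z.1) (U ×ˢ J)) (hU : IsOpen U)
    (h : ∀ t ∈ J, IsConvexPatch U (X t) (N t)) (α : ℝ) :
    ContDiffOn ℝ ∞ (fun z : Euc n × ℝ => translationVector α (X z.2) (N z.2) z.1) (U ×ˢ J) := by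
  have hu := contDiffOn_speed hJ hX hN hU h α
  refine ContDiffOn.add (ContDiffOn.sum fun i _ => ContDiffOn.sum fun j _ => ?_) (hu.smul hN)
  exact ((contDiffOn_invSecondForm hJ hX hN hU h i j).mul
    (contDiffOn_pd (f := fun s => speed α (X s) (N s)) hU hJ hu i)).smul (contDiffOn_pd hU hJ hX j)

end Family

/-! ### The flow in a coordinate patch -/

section Patch

variable {n : ℕ} {V : Type*} [NormedAddCommGroup V] [NormedSpace ℝ V]

/-- The `i`-th coordinate direction of space-time. -/
def spaceDir (i : Fin n) : Euc n × ℝ := (EuclideanSpace.single i (1 : ℝ), 0)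

/-- The time direction of space-time. -/
def timeDir (n : ℕ) : Euc n × ℝ := (0, 1)

lemma fderiv_spaceDir {f : ℝ → Euc n → V} {z : Euc n × ℝ}
    (hf : DifferentiableAt ℝ (fun z : Euc n × ℝ => f z.2 z.1) z) (i : Fin n) :
    fderiv ℝ (fun z : Euc n × ℝ => f z.2 z.1) z (spaceDir i) = pd i (f z.2) z.1 := by
  have h := HasFDerivAt.comp (g := fun z : Euc n × ℝ => f z.2 z.1) (f := fun y => (y, z.2)) z.1 hf.hasFDerivAt
    (hasFDerivAt_prodMk_left (𝕜 := ℝ) z.1 z.2)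
  have h' : HasFDerivAt (f z.2) _ z.1 := h
  rw [pd, h'.fderiv]
  rfl

lemma fderiv_timeDir {f : ℝ → Euc n → V} {z : Euc n × ℝ}
    (hf : DifferentiableAt ℝ (fun z : Euc n × ℝ => f z.2 z.1) z) :
    fderiv ℝ (fun z : Euc n × ℝ => f z.2 z.1) z (timeDir n) = deriv (fun s => f s z.1) z.2 := by
  have h := HasFDerivAt.comp (g := fun z : Euc n × ℝ => f z.2 z.1) (f := fun s => (z.1, s)) z.2 hf.hasFDerivAt
    (hasFDerivAt_prodMk_right (𝕜 := ℝ) z.1 z.2)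
  have h' : HasFDerivAt (fun s => f s z.1) _ z.2 := h
  rw [← fderiv_apply_one_eq_deriv, h'.fderiv]
  rfl

lemma clm_eq_zero_of_spaceDir_timeDir {L : Euc n × ℝ →L[ℝ] V} (hs : ∀ i, L (spaceDir i) = 0)
    (ht : L (timeDir n) = 0) : L = 0 := by
  refine ContinuousLinearMap.prod_ext ?_ ?_
  · refine ContinuousLinearMap.coe_injective
      ((EuclideanSpace.basisFun (Fin n) ℝ).toBasis.ext fun i => ?_)
    simpa [spaceDir] using hs i
  · ext
    simpa [timeDir] using ht

variable {U : Set (Euc n)} {X N : ℝ → Euc n → Euc (n + 1)} {α ε : ℝ}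

/-- The translation vector of a flow with `P = 0` has vanishing space-time derivative at interior
times. The field `V = ∂ₜ - bⁱʲ ∇ᵢK^α ∂ⱼ` transports the hypersurfaces with fixed normals, and
`P = 0` says that the speed is constant along `V`. -/
lemma fderiv_translationVector_eq_zero (hU : IsOpen U) (hα : 0 < α) (hε : 0 < ε)
    (hX : ContDiffOn ℝ ∞ (fun z : Euc n × ℝ => X z.2 z.1) (U ×ˢ Icc (-ε) ε))
    (hN : ContDiffOn ℝ ∞ (fun z : Euc n × ℝ => N z.2 z.1) (U ×ˢ Icc (-ε) ε))
    (h : ∀ t ∈ Icc (-ε) ε, IsConvexPatch U (X t) (N t))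
    (hflow : ∀ x ∈ U, ∀ t ∈ Icc (-ε) ε, derivWithin (fun s => X s x) (Icc (-ε) ε) t
      = -(speed α (X t) (N t) x • N t x))
    (hP : ∀ x ∈ U, ∀ t ∈ Icc (-ε) ε, chowScalar α (Icc (-ε) ε) X N t x = 0) :
    ∀ z ∈ U ×ˢ Ioo (-ε) ε,
      fderiv ℝ (fun z : Euc n × ℝ => translationVector α (X z.2) (N z.2) z.1) z = 0 := by
  have hJ : UniqueDiffOn ℝ (Icc (-ε) ε) := uniqueDiffOn_Icc (by linarith)
  have hΩ : IsOpen (U ×ˢ Ioo (-ε) ε) := hU.prod isOpen_Ioo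
  have hsub : U ×ˢ Ioo (-ε) ε ⊆ U ×ˢ Icc (-ε) ε := prod_mono_right Ioo_subset_Icc_self
  have hJt : ∀ {z : Euc n × ℝ}, z ∈ U ×ˢ Ioo (-ε) ε → z.2 ∈ Icc (-ε) ε := fun hz => (hsub hz).2
  set u : ℝ → Euc n → ℝ := fun s => speed α (X s) (N s) with hudef
  set w : Fin n → Euc n × ℝ → ℝ := fun j z =>
    ∑ i, invSecondForm (X z.2) (N z.2) z.1 i j * pd i (u z.2) z.1 with hwdef
  set V : Euc n × ℝ → Euc n × ℝ := fun z => timeDir n - ∑ j, w j z • spaceDir j with hVdef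
  set T : ℝ → Euc n → Euc (n + 1) := fun s => translationVector α (X s) (N s) with hTdef
  have hu0 : ContDiffOn ℝ ∞ (fun z : Euc n × ℝ => u z.2 z.1) (U ×ˢ Icc (-ε) ε) :=
    contDiffOn_speed hJ hX hN hU h α
  have hT : ContDiffOn ℝ ∞ (fun z : Euc n × ℝ => T z.2 z.1) (U ×ˢ Ioo (-ε) ε) :=
    (contDiffOn_translationVector hJ hX hN hU h α).mono hsub
  have hw : ∀ j, ContDiffOn ℝ ∞ (w j) (U ×ˢ Ioo (-ε) ε) := fun j =>
    (ContDiffOn.sum fun i _ => (contDiffOn_invSecondForm hJ hX hN hU h i j).mul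
      (contDiffOn_pd hU hJ hu0 i)).mono hsub
  have hV : ContDiffOn ℝ ∞ V (U ×ˢ Ioo (-ε) ε) :=
    contDiffOn_const.sub (ContDiffOn.sum fun j _ => (hw j).smul contDiffOn_const)
  replace hX := hX.mono hsub
  replace hN := hN.mono hsub
  have hu := hu0.mono hsub
  have hdX := fun {z} hz => differentiableAt_of_contDiffOn hΩ hX (z := z) hz
  have hdN := fun {z} hz => differentiableAt_of_contDiffOn hΩ hN (z := z) hz
  have hdu := fun {z} hz => differentiableAt_of_contDiffOn hΩ hu (z := z) hz
  have hnhds : ∀ {z : Euc n × ℝ}, z ∈ U ×ˢ Ioo (-ε) ε → Icc (-ε) ε ∈ nhds z.2 := fun hz =>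
    Icc_mem_nhds hz.2.1 hz.2.2
  have hXt : ∀ z ∈ U ×ˢ Ioo (-ε) ε, fderiv ℝ (fun z : Euc n × ℝ => X z.2 z.1) z (timeDir n)
      = -(u z.2 z.1 • N z.2 z.1) := by
    intro z hz
    rw [fderiv_timeDir (hdX hz), ← hflow z.1 hz.1 z.2 (hJt hz),
      derivWithin_of_mem_nhds (hnhds hz)]
  have hsymm : ∀ z ∈ U ×ˢ Ioo (-ε) ε, ∀ k, ∑ j, w j z
      * secondForm (X z.2) (N z.2) z.1 j k = pd k (u z.2) z.1 := by
    intro z hz k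
    rw [← (h z.2 (hJt hz)).sum_sum_invSecondForm_mul hz.1 (fun i => pd i (u z.2) z.1),
      Finset.sum_comm]
    exact Finset.sum_congr rfl fun j _ => Finset.sum_mul _ _ _
  -- the evolution of the normal is `∂ₜN = ∇K^α`: it is tangential and pairs with `∂ₖX` to `∂ₖK^α`
  have hNt : ∀ z ∈ U ×ˢ Ioo (-ε) ε,
      inner ℝ (fderiv ℝ (fun z : Euc n × ℝ => N z.2 z.1) z (timeDir n)) (N z.2 z.1) = 0 := by
    intro z hz
    have h1 : (fun z : Euc n × ℝ => (inner ℝ (N z.2 z.1) (N z.2 z.1) : ℝ)) =ᶠ[nhds z]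
        fun _ => 1 := by
      filter_upwards [hΩ.mem_nhds hz] with y hy
      rw [real_inner_self_eq_norm_sq, (h y.2 (hJt hy)).unit y.1 hy.1, one_pow]
    have h2 := fderiv_inner_apply ℝ (hdN hz) (hdN hz) (timeDir n)
    rw [h1.fderiv_eq, real_inner_comm] at h2
    simp only [fderiv_fun_const, Pi.zero_apply, zero_apply] at h2
    linarith
  have hNtX : ∀ z ∈ U ×ˢ Ioo (-ε) ε, ∀ k,
      inner ℝ (fderiv ℝ (fun z : Euc n × ℝ => N z.2 z.1) z (timeDir n)) (pd k (X z.2) z.1)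
        = pd k (u z.2) z.1 := by
    intro z hz k
    have h1 : (fun y : Euc n × ℝ => (inner ℝ (N y.2 y.1)
        (fderiv ℝ (fun z : Euc n × ℝ => X z.2 z.1) y (spaceDir k)) : ℝ)) =ᶠ[nhds z]
        fun _ => 0 := by
      filter_upwards [hΩ.mem_nhds hz] with y hy
      rw [fderiv_spaceDir (hdX hy), real_inner_comm, (h y.2 (hJt hy)).normal y.1 hy.1]
    have h2 := fderiv_inner_apply ℝ (hdN hz) (differentiableAt_of_contDiffOn hΩ
      (contDiffOn_fderiv_apply hΩ hX (spaceDir k)) hz) (timeDir n)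
    have h3 : (fun y => fderiv ℝ (fun z : Euc n × ℝ => X z.2 z.1) y (timeDir n)) =ᶠ[nhds z]
        fun y => -(u y.2 y.1 • N y.2 y.1) := by
      filter_upwards [hΩ.mem_nhds hz] with y hy using hXt y hy
    rw [h1.fderiv_eq, fderiv_fderiv_comm hΩ hX hz, h3.fderiv_eq, fderiv_fun_neg,
      fderiv_fun_smul (hdu hz) (hdN hz), fderiv_spaceDir (hdX hz)] at h2
    simp only [fderiv_fun_const, Pi.zero_apply, zero_apply, neg_apply, add_apply, smul_apply,
      ContinuousLinearMap.smulRight_apply, inner_neg_right, inner_add_right,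
      real_inner_smul_right] at h2
    rw [fderiv_spaceDir (hdu hz), fderiv_spaceDir (hdN hz), real_inner_self_eq_norm_sq,
      (h z.2 (hJt hz)).unit z.1 hz.1, real_inner_comm (pd k (N z.2) z.1),
      (h z.2 (hJt hz)).inner_pd_normal_self hz.1] at h2
    linarith
  have hVapply : ∀ {W : Type} [NormedAddCommGroup W] [NormedSpace ℝ W]
      {f : ℝ → Euc n → W} {z : Euc n × ℝ}, DifferentiableAt ℝ (fun z : Euc n × ℝ => f z.2 z.1) z →
      fderiv ℝ (fun z : Euc n × ℝ => f z.2 z.1) z (V z)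
        = fderiv ℝ (fun z : Euc n × ℝ => f z.2 z.1) z (timeDir n)
          - ∑ j, w j z • pd j (f z.2) z.1 := by
    intro W _ _ f z hf
    simp only [hVdef, map_sub, map_sum, map_smul, fderiv_spaceDir hf]
  have hpair : ∀ z ∈ U ×ˢ Ioo (-ε) ε, pairing (spaceDir (n := n))
      (fun z : Euc n × ℝ => X z.2 z.1) (fun z : Euc n × ℝ => N z.2 z.1) z
      = secondForm (X z.2) (N z.2) z.1 := by
    intro z hz
    ext i j
    rw [(h z.2 (hJt hz)).secondForm_eq_inner hz.1, pairing, Matrix.of_apply,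
      fderiv_spaceDir (hdX hz), fderiv_spaceDir (hdN hz)]
  -- `∂ᵢV = -∑ⱼ (∂ᵢwʲ) ∂ⱼ`, so the matrix `A` of the transport is `∂ᵢwʲ`
  have hmain := fderiv_translation_eq_zero hΩ (X := fun z : Euc n × ℝ => X z.2 z.1)
    (N := fun z : Euc n × ℝ => N z.2 z.1) (T := fun z : Euc n × ℝ => T z.2 z.1)
    (u := fun z : Euc n × ℝ => u z.2 z.1) (V := V) (e := spaceDir)
    (K := fun z => gaussCurvature (X z.2) (N z.2) z.1)
    (A := fun z => Matrix.of fun i j => fderiv ℝ (w j) z (spaceDir i)) hα.ne' hX hN hT hu hV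
    (fun z hz i => by
      have hd := fun j => (differentiableAt_of_contDiffOn hΩ (hw j) hz).smul_const (spaceDir j)
      rw [hVdef, fderiv_const_sub, fderiv_fun_sum fun j _ => hd j]
      simp only [neg_apply, sum_apply, Matrix.of_apply]
      refine congrArg Neg.neg (Finset.sum_congr rfl fun j _ => ?_)
      rw [fderiv_smul_const (differentiableAt_of_contDiffOn hΩ (hw j) hz)]
      rfl)
    (fun z hz => by
      rw [hVapply (hdX hz), hXt z hz]
      simp only [hTdef, hwdef, translationVector, Finset.sum_smul, neg_add]
      rw [Finset.sum_comm]
      exact (sub_eq_add_neg _ _).trans (add_comm _ _))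
    (fun z hz => by
      rw [hVapply (hdN hz)]
      have hp := h z.2 (hJt hz)
      refine eq_zero_of_inner_frame_eq_zero (hp.immersion z.1 hz.1) (hp.unit z.1 hz.1)
        (hp.normal z.1 hz.1) (fun k => ?_) ?_
      · rw [inner_sub_left, hNtX z hz, sum_inner, ← hsymm z hz k, sub_eq_zero]
        refine Finset.sum_congr rfl fun j _ => ?_
        rw [real_inner_smul_left, hp.secondForm_eq_inner' hz.1, real_inner_comm]
      · rw [inner_sub_left, hNt z hz, sum_inner]
        simp [real_inner_smul_left, hp.inner_pd_normal_self hz.1])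
    (fun z hz => by
      rw [hVapply (hdu hz), fderiv_timeDir (hdu hz)]
      have h1 := hP z.1 hz.1 z.2 (hJt hz)
      have hupos := (h z.2 (hJt hz)).speed_pos α hz.1
      rw [chowScalar, mul_eq_zero, derivWithin_of_mem_nhds (hnhds hz)] at h1
      have h2 := h1.resolve_left (one_div_ne_zero (mul_pos hα hupos).ne')
      rw [← h2, Finset.sum_comm]
      simp only [hwdef, smul_eq_mul, Finset.sum_mul, hudef])
    (fun z hz => (h z.2 (hJt hz)).inner_translationVector_normal α hz.1)
    (fun z hz i => by
      rw [fderiv_spaceDir (hdN hz), fderiv_spaceDir (hdu hz)]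
      exact (h z.2 (hJt hz)).inner_translationVector_pd_normal α hz.1 i)
    (fun z hz v hv hvN => (h z.2 (hJt hz)).eq_zero_of_inner_pd_normal hz.1
      (fun i => by rw [← fderiv_spaceDir (hdN hz)]; exact hv i) hvN)
    (fun z hz => by rw [hpair z hz]; exact (h z.2 (hJt hz)).convex z.1 hz.1)
    (fun z hz => (h z.2 (hJt hz)).gaussCurvature_pos hz.1)
    (fun z hz => by
      rw [hpair z hz, ← (h z.2 (hJt hz)).det_thirdForm hz.1]
      congr 1
      ext i j
      rw [pairing, Matrix.of_apply, Matrix.of_apply, fderiv_spaceDir (hdN hz),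
        fderiv_spaceDir (hdN hz)])
    (fun z hz => rfl)
  intro z hz
  obtain ⟨h1, h2⟩ := hmain z hz
  refine clm_eq_zero_of_spaceDir_timeDir h1 ?_
  have h3 : fderiv ℝ (fun z : Euc n × ℝ => T z.2 z.1) z (V z)
      = fderiv ℝ (fun z : Euc n × ℝ => T z.2 z.1) z (timeDir n) := by
    simp only [hVdef, map_sub, map_sum, map_smul, h1, smul_zero, Finset.sum_const_zero, sub_zero]
  rw [← h3, h2]

/-- In a coordinate patch the translation vector of a flow with `P = 0` is locally constant in space
and constant in time, up to the end points of the time interval. -/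
lemma translationVector_locally_const (hU : IsOpen U) (hα : 0 < α) (hε : 0 < ε)
    (hX : ContDiffOn ℝ ∞ (fun z : Euc n × ℝ => X z.2 z.1) (U ×ˢ Icc (-ε) ε))
    (hN : ContDiffOn ℝ ∞ (fun z : Euc n × ℝ => N z.2 z.1) (U ×ˢ Icc (-ε) ε))
    (h : ∀ t ∈ Icc (-ε) ε, IsConvexPatch U (X t) (N t))
    (hflow : ∀ x ∈ U, ∀ t ∈ Icc (-ε) ε, derivWithin (fun s => X s x) (Icc (-ε) ε) t
      = -(speed α (X t) (N t) x • N t x))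
    (hP : ∀ x ∈ U, ∀ t ∈ Icc (-ε) ε, chowScalar α (Icc (-ε) ε) X N t x = 0)
    {x : Euc n} (hx : x ∈ U) :
    ∃ r > 0, ∀ y ∈ Metric.ball x r, ∀ t ∈ Icc (-ε) ε,
      translationVector α (X t) (N t) y = translationVector α (X 0) (N 0) x := by
  obtain ⟨r, hr, hrU⟩ := Metric.isOpen_iff.1 hU x hx
  have hT := contDiffOn_translationVector (uniqueDiffOn_Icc (by linarith)) hX hN hU h α
  have hsub : Metric.ball x r ×ˢ Ioo (-ε) ε ⊆ U ×ˢ Ioo (-ε) ε := prod_mono_left hrU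
  have hsub' : U ×ˢ Ioo (-ε) ε ⊆ U ×ˢ Icc (-ε) ε := prod_mono_right Ioo_subset_Icc_self
  have h0 : (0 : ℝ) ∈ Ioo (-ε) ε := ⟨by linarith, hε⟩
  have hconst : ∀ a ∈ Metric.ball x r ×ˢ Ioo (-ε) ε, ∀ b ∈ Metric.ball x r ×ˢ Ioo (-ε) ε,
      translationVector α (X a.2) (N a.2) a.1 = translationVector α (X b.2) (N b.2) b.1 :=
    fun a ha b hb => (Metric.isOpen_ball.prod isOpen_Ioo).is_const_of_fderiv_eq_zero (𝕜 := ℝ)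
    ((convex_ball x r).prod (convex_Ioo (-ε) ε)).isPreconnected
    ((hT.differentiableOn (by simp)).mono (hsub.trans hsub'))
    (fun z hz => fderiv_translationVector_eq_zero hU hα hε hX hN h hflow hP z (hsub hz))
    ha hb
  refine ⟨r, hr, fun y hy => ?_⟩
  have hcont : ContinuousOn (fun t => translationVector α (X t) (N t) y) (Icc (-ε) ε) :=
    hT.continuousOn.comp (f := fun t : ℝ => (y, t)) (by fun_prop) fun t ht => ⟨hrU hy, ht⟩
  -- the end points of the time interval are reached by continuity
  refine EqOn.of_subset_closure (s := Ioo (-ε) ε) (fun t ht => ?_) hcont continuousOn_const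
    Ioo_subset_Icc_self (by rw [closure_Ioo (by linarith)])
  exact hconst (y, t) ⟨hy, ht⟩ (x, 0) ⟨Metric.mem_ball_self hr, h0⟩

end Patch

/-! ### Change of coordinates -/

section CoordinateChange

variable {n : ℕ} {V : Type*} [NormedAddCommGroup V] [NormedSpace ℝ V]
  {U U' W : Set (Euc n)} {X N X' N' : Euc n → Euc (n + 1)} {τ : Euc n → Euc n}

/-- The Jacobian matrix `∂ᵢτᵃ` of a map between coordinate domains. -/
def jacobian (τ : Euc n → Euc n) (x : Euc n) : Matrix (Fin n) (Fin n) ℝ :=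
  Matrix.of fun i a => pd i τ x a

lemma pd_comp {f g : Euc n → V} {x : Euc n} (hW : IsOpen W) (hx : x ∈ W)
    (hf : ∀ y ∈ W, f y = g (τ y)) (hg : DifferentiableAt ℝ g (τ x))
    (hτ : DifferentiableAt ℝ τ x) (i : Fin n) :
    pd i f x = ∑ a, jacobian τ x i a • pd a g (τ x) := by
  have h1 : pd i τ x = ∑ a, jacobian τ x i a • EuclideanSpace.single a (1 : ℝ) := by
    have := (EuclideanSpace.basisFun (Fin n) ℝ).sum_repr (pd i τ x)
    simpa [jacobian] using this.symm
  rw [pd_congr hW hf hx]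
  have h2 : pd i (fun y => g (τ y)) x = fderiv ℝ g (τ x) (pd i τ x) := by
    rw [pd, fderiv_fun_comp x hg hτ]; rfl
  rw [h2, h1]
  simp only [map_sum, map_smul, pd]

lemma gram_comp {E : Type*} [NormedAddCommGroup E] [InnerProductSpace ℝ E]
    (B : Matrix (Fin n) (Fin n) ℝ)
    (v v' : Fin n → E) :
    (Matrix.of fun i j => (inner ℝ (∑ a, B i a • v a) (∑ b, B j b • v' b) : ℝ))
      = B * Matrix.of (fun a b => (inner ℝ (v a) (v' b) : ℝ)) * Bᵀ := by
  ext i j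
  simp only [Matrix.of_apply, Matrix.mul_apply, Matrix.transpose_apply, sum_inner, inner_sum,
    real_inner_smul_left, real_inner_smul_right, Finset.sum_mul]
  exact Finset.sum_congr rfl fun b _ => Finset.sum_congr rfl fun a _ => by ring

/-- The translation vector does not depend on the coordinates. -/
lemma translationVector_comp (h : IsConvexPatch U X N) (h' : IsConvexPatch U' X' N')
    (hW : IsOpen W) (hWU : W ⊆ U) (hWU' : ∀ y ∈ W, τ y ∈ U')
    (hτ : ∀ y ∈ W, DifferentiableAt ℝ τ y) (hX : ∀ y ∈ W, X y = X' (τ y))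
    (hN : ∀ y ∈ W, N y = N' (τ y)) {α : ℝ}
    (hu' : ∀ y ∈ U', DifferentiableAt ℝ (speed α X' N') y) {x : Euc n} (hx : x ∈ W) :
    translationVector α X N x = translationVector α X' N' (τ x) := by
  have hpX : ∀ y ∈ W, ∀ i, pd i X y = ∑ a, jacobian τ y i a • pd a X' (τ y) := fun y hy =>
    pd_comp hW hy hX (differentiableAt_of_contDiffOn h'.isOpen h'.smooth (hWU' y hy)) (hτ y hy)
  have hpN : ∀ y ∈ W, ∀ i, pd i N y = ∑ a, jacobian τ y i a • pd a N' (τ y) := fun y hy =>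
    pd_comp hW hy hN (differentiableAt_of_contDiffOn h'.isOpen h'.smooth_normal (hWU' y hy))
      (hτ y hy)
  have hu : ∀ y ∈ W, speed α X N y = speed α X' N' (τ y) := by
    intro y hy
    have hg : metric X y = jacobian τ y * metric X' (τ y) * (jacobian τ y)ᵀ := by
      have := gram_comp (jacobian τ y) (fun a => pd a X' (τ y)) (fun a => pd a X' (τ y))
      simp only [← hpX y hy] at this
      exact this
    have hh : secondForm X N y = jacobian τ y * secondForm X' N' (τ y) * (jacobian τ y)ᵀ := by
      have := gram_comp (jacobian τ y) (fun a => pd a X' (τ y)) (fun a => pd a N' (τ y))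
      simp only [← hpX y hy, ← hpN y hy, ← h.secondForm_eq_inner (hWU hy),
        ← h'.secondForm_eq_inner (hWU' y hy)] at this
      exact this
    have hd : (jacobian τ y).det ≠ 0 := by
      intro h0
      have := (h.det_secondForm_pos (hWU hy)).ne'
      rw [hh, Matrix.det_mul, Matrix.det_mul, h0] at this
      simp at this
    have hd' := (h'.det_metric_pos (hWU' y hy)).ne'
    rw [speed, speed, gaussCurvature, gaussCurvature, hg, hh]
    congr 1
    simp only [Matrix.det_nonsing_inv, Ring.inverse_eq_inv', Matrix.det_mul, Matrix.det_transpose]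
    field_simp
  rw [← sub_eq_zero]
  refine h.eq_zero_of_inner_pd_normal (hWU hx) (fun i => ?_) ?_
  · rw [inner_sub_left, h.inner_translationVector_pd_normal α (hWU hx),
      pd_comp hW hx hu (hu' _ (hWU' x hx)) (hτ x hx), hpN x hx, inner_sum]
    simp [real_inner_smul_right, h'.inner_translationVector_pd_normal α (hWU' x hx)]
  · rw [inner_sub_left, h.inner_translationVector_normal α (hWU hx), hN x hx,
      h'.inner_translationVector_normal α (hWU' x hx), hu x hx, sub_self]

end CoordinateChange

/-! ### From charts to the manifold -/

section Manifold

variable {n : ℕ} {M : Type*} [TopologicalSpace M] [ChartedSpace (Euc n) M]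
  {J : Set ℝ} {F ν : M → ℝ → Euc (n + 1)} {φ ψ : OpenPartialHomeomorph M (Euc n)}

lemma contDiffOn_inChart [IsManifold (𝓡 n) ∞ M] (hφ : φ ∈ charts n M)
    (hF : ContMDiffOn ((𝓡 n).prod 𝓘(ℝ, ℝ)) 𝓘(ℝ, Euc (n + 1)) ∞
      (fun q : M × ℝ => F q.1 q.2) (univ ×ˢ J)) :
    ContDiffOn ℝ ∞ (fun z : Euc n × ℝ => inChart φ F z.2 z.1) (φ.target ×ˢ J) := by
  rw [← contMDiffOn_iff_contDiffOn]
  have h1 : ContMDiffOn 𝓘(ℝ, Euc n × ℝ) (𝓡 n) ∞ (fun z : Euc n × ℝ => φ.symm z.1)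
      (φ.target ×ˢ J) :=
    (contMDiffOn_symm_of_mem_maximalAtlas (I := 𝓡 n) (n := ∞) hφ).comp
      contDiff_fst.contMDiff.contMDiffOn fun z hz => hz.1
  have h2 : ContMDiffOn 𝓘(ℝ, Euc n × ℝ) 𝓘(ℝ, ℝ) ∞ (fun z : Euc n × ℝ => z.2)
      (φ.target ×ˢ J) := contDiff_snd.contMDiff.contMDiffOn
  exact hF.comp (h1.prodMk h2) fun z hz => ⟨mem_univ _, hz.2⟩

namespace IsStrictlyConvexFamily

variable [IsManifold (𝓡 n) ∞ M]

lemma isConvexPatch (h : IsStrictlyConvexFamily (n := n) J F ν) (hφ : φ ∈ charts n M) {t : ℝ}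
    (ht : t ∈ J) : IsConvexPatch φ.target (inChart φ F t) (inChart φ ν t) where
  isOpen := φ.open_target
  smooth := contDiffOn_slice (contDiffOn_inChart hφ h.smooth) ht
  smooth_normal := contDiffOn_slice (contDiffOn_inChart hφ h.smooth_normal) ht
  immersion x hx := h.immersion φ hφ x hx t ht
  unit x _ := h.unit (φ.symm x) t ht
  normal x hx := h.normal φ hφ x hx t ht
  convex x hx := h.convex φ hφ x hx t ht

/-- The translation vectors computed in two charts agree at corresponding points. -/
lemma translationVector_eq (h : IsStrictlyConvexFamily (n := n) J F ν) (hJ : UniqueDiffOn ℝ J)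
    (hφ : φ ∈ charts n M) (hψ : ψ ∈ charts n M) (α : ℝ) {t : ℝ} (ht : t ∈ J) {x : Euc n}
    (hx : x ∈ φ.target) (hxψ : φ.symm x ∈ ψ.source) :
    translationVector α (inChart φ F t) (inChart φ ν t) x
      = translationVector α (inChart ψ F t) (inChart ψ ν t) (ψ (φ.symm x)) := by
  have hsrc : (φ.symm.trans ψ).source = φ.target ∩ φ.symm ⁻¹' ψ.source := by
    simp
  have hW : IsOpen (φ.target ∩ φ.symm ⁻¹' ψ.source) := hsrc ▸ (φ.symm.trans ψ).open_source
  have hτ : ContDiffOn ℝ ∞ (fun y => ψ (φ.symm y)) (φ.target ∩ φ.symm ⁻¹' ψ.source) := by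
    rw [← contMDiffOn_iff_contDiffOn]
    exact (contMDiffOn_of_mem_maximalAtlas (I := 𝓡 n) (n := ∞) hψ).comp
      ((contMDiffOn_symm_of_mem_maximalAtlas (I := 𝓡 n) (n := ∞) hφ).mono inter_subset_left)
      fun y hy => hy.2
  have hu := contDiffOn_slice (f := fun s => speed α (inChart ψ F s) (inChart ψ ν s))
    (contDiffOn_speed hJ (contDiffOn_inChart hψ h.smooth) (contDiffOn_inChart hψ h.smooth_normal)
      ψ.open_target (fun _ hs => h.isConvexPatch hψ hs) α) ht
  refine translationVector_comp (τ := fun y => ψ (φ.symm y)) (h.isConvexPatch hφ ht)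
    (h.isConvexPatch hψ ht) hW inter_subset_left (fun y hy => ψ.map_source hy.2)
    (fun y hy => differentiableAt_of_contDiffOn hW hτ hy) (fun y hy => ?_) (fun y hy => ?_)
    (fun y hy => differentiableAt_of_contDiffOn ψ.open_target hu hy) ⟨hx, hxψ⟩
  all_goals simp only [inChart]; rw [ψ.left_inv hy.2]

end IsStrictlyConvexFamily

/-! ### Translates of a hypersurface -/

lemma inChart_add_smul {M : Type*} [TopologicalSpace M]
    {φ : OpenPartialHomeomorph M (Euc n)} (f : M → Euc (n + 1)) (V : Euc (n + 1)) (t : ℝ) :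
    inChart φ (fun p s => f p + s • V) t = fun x => f (φ.symm x) + t • V := rfl

lemma pd_add_const {W : Type*} [NormedAddCommGroup W] [NormedSpace ℝ W] (f : Euc n → W) (c : W)
    (i : Fin n) : pd i (fun x => f x + c) = pd i f := by
  funext x
  rw [pd, fderiv_add_const, pd]

lemma metric_add_const (X : Euc n → Euc (n + 1)) (c : Euc (n + 1)) :
    metric (fun x => X x + c) = metric X := by
  funext x
  simp only [metric, pd_add_const]

lemma secondForm_add_const (X N : Euc n → Euc (n + 1)) (c : Euc (n + 1)) :
    secondForm (fun x => X x + c) N = secondForm X N := by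
  funext x
  simp only [secondForm, pd_add_const]

lemma speed_add_const (α : ℝ) (X N : Euc n → Euc (n + 1)) (c : Euc (n + 1)) :
    speed α (fun x => X x + c) N = speed α X N := by
  funext x
  simp only [speed, gaussCurvature, metric_add_const, secondForm_add_const]

/-- A time slice of a strictly convex family, all of whose translation vectors are equal to `T`, is
a translating soliton with velocity `-T`, because `⟨T, ν⟩ = K^α`. -/
lemma IsStrictlyConvexFamily.isTranslatingSoliton [IsManifold (𝓡 n) ∞ M]
    (h : IsStrictlyConvexFamily (n := n) J F ν) {α t₀ : ℝ} (ht₀ : t₀ ∈ J) {T : Euc (n + 1)}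
    (hT : ∀ φ ∈ charts n M, ∀ x ∈ φ.target,
      translationVector α (inChart φ F t₀) (inChart φ ν t₀) x = T) :
    IsTranslatingSoliton (n := n) α (fun p => F p t₀) (fun p => ν p t₀) (-T) := by
  have hslice : ContMDiff ((𝓡 n).prod 𝓘(ℝ, ℝ)) ((𝓡 n).prod 𝓘(ℝ, ℝ)) ∞
      (fun q : M × ℝ => (q.1, t₀)) := contMDiff_fst.prodMk contMDiff_const
  have hmaps : MapsTo (fun q : M × ℝ => (q.1, t₀)) (univ ×ˢ univ) (univ ×ˢ J) :=
    fun q _ => ⟨mem_univ _, ht₀⟩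
  refine ⟨⟨?_, ?_, ?_, ?_, ?_, ?_⟩, ?_⟩
  · refine (h.smooth.comp hslice.contMDiffOn hmaps).add ?_
    have : ContDiff ℝ ∞ fun t : ℝ => t • (-T) := contDiff_id.smul contDiff_const
    exact (this.contMDiff.comp contMDiff_snd).contMDiffOn
  · exact h.smooth_normal.comp hslice.contMDiffOn hmaps
  · intro φ hφ x hx t _
    simp only [inChart_add_smul, pd_add_const]
    exact h.immersion φ hφ x hx t₀ ht₀
  · exact fun p _ _ => h.unit p t₀ ht₀
  · intro φ hφ x hx t _ i
    simp only [inChart_add_smul, pd_add_const]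
    exact h.normal φ hφ x hx t₀ ht₀ i
  · intro φ hφ x hx t _
    simp only [inChart_add_smul, secondForm_add_const]
    exact h.convex φ hφ x hx t₀ ht₀
  · intro φ hφ x hx t
    have hd : deriv (fun s : ℝ => F (φ.symm x) t₀ + s • (-T)) t = -T := by
      have h1 : HasDerivAt (fun s : ℝ => F (φ.symm x) t₀ + s • (-T)) ((1 : ℝ) • (-T)) t :=
        ((hasDerivAt_id t).smul_const (-T)).const_add _
      rw [h1.deriv, one_smul]
    rw [hd, inner_neg_left, inChart_add_smul, speed_add_const, ← hT φ hφ x hx]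
    exact congrArg Neg.neg ((h.isConvexPatch hφ ht₀).inner_translationVector_normal α hx)

end Manifold

end GCF

end

theorem lemma5p4 {n : ℕ} (hn : 1 ≤ n) {M : Type*} [TopologicalSpace M]
    [ChartedSpace (GCF.Euc n) M] [IsManifold (𝓡 n) ∞ M] [T2Space M] [ConnectedSpace M]
    {α ε : ℝ} (hα : 0 < α) (hε : 0 < ε) (F ν : M → ℝ → GCF.Euc (n + 1))
    (hF : GCF.IsGaussCurvatureFlow α (Icc (-ε) ε) F ν)
    (hP : ∀ φ ∈ GCF.charts n M, ∀ x ∈ φ.target, ∀ t ∈ Icc (-ε) ε,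
      GCF.chowScalar α (Icc (-ε) ε) (GCF.inChart φ F) (GCF.inChart φ ν) t x = 0) :
    (∀ φ ∈ GCF.charts n M, ∀ x ∈ φ.target, ∀ t ∈ Icc (-ε) ε, ∀ i j : Fin n,
      GCF.chowTensor α (GCF.inChart φ F t) (GCF.inChart φ ν t) i j x = 0) ∧
    ∃ T : GCF.Euc (n + 1),
      (∀ φ ∈ GCF.charts n M, ∀ x ∈ φ.target, ∀ t ∈ Icc (-ε) ε,
        GCF.translationVector α (GCF.inChart φ F t) (GCF.inChart φ ν t) x = T) ∧
      GCF.IsTranslatingSoliton α (fun p => F p 0) (fun p => ν p 0) (-T) := by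
  have hconv := hF.toIsStrictlyConvexFamily
  have hJ : UniqueDiffOn ℝ (Icc (-ε) ε) := uniqueDiffOn_Icc (by linarith)
  have h0 : (0 : ℝ) ∈ Icc (-ε) ε := ⟨by linarith, hε.le⟩
  have hlocal : ∀ φ ∈ GCF.charts n M, ∀ x ∈ φ.target, ∃ r > 0, ∀ y ∈ Metric.ball x r,
      ∀ t ∈ Icc (-ε) ε, GCF.translationVector α (GCF.inChart φ F t) (GCF.inChart φ ν t) y
        = GCF.translationVector α (GCF.inChart φ F 0) (GCF.inChart φ ν 0) x :=
    fun φ hφ x hx => GCF.translationVector_locally_const φ.open_target hα hε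
      (GCF.contDiffOn_inChart hφ hconv.smooth) (GCF.contDiffOn_inChart hφ hconv.smooth_normal)
      (fun t ht => hconv.isConvexPatch hφ ht) (fun y hy t ht => hF.flow φ hφ y hy t ht)
      (fun y hy t ht => hP φ hφ y hy t ht) hx
  have hchart : ∀ p : M, chartAt (GCF.Euc n) p ∈ GCF.charts n M := fun p =>
    IsManifold.chart_mem_maximalAtlas p
  -- the translation vector as a function on `M`, evaluated in the preferred charts
  let G : M → GCF.Euc (n + 1) := fun p =>
    GCF.translationVector α (GCF.inChart (chartAt (GCF.Euc n) p) F 0)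
      (GCF.inChart (chartAt (GCF.Euc n) p) ν 0) (chartAt (GCF.Euc n) p p)
  have hG : ∀ φ ∈ GCF.charts n M, ∀ x ∈ φ.target,
      GCF.translationVector α (GCF.inChart φ F 0) (GCF.inChart φ ν 0) x = G (φ.symm x) :=
    fun φ hφ x hx => hconv.translationVector_eq hJ hφ (hchart _) α h0 hx (mem_chart_source _ _)
  have hGloc : IsLocallyConstant G := by
    rw [IsLocallyConstant.iff_eventually_eq]
    intro p
    set φ := chartAt (GCF.Euc n) p with hφdef
    have hp : p ∈ φ.source := mem_chart_source _ _
    obtain ⟨r, hr, hball⟩ := hlocal φ (hchart p) (φ p) (φ.map_source hp)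
    filter_upwards [φ.open_source.mem_nhds hp,
      (φ.continuousAt hp).preimage_mem_nhds (Metric.ball_mem_nhds _ hr)] with q hq hqr
    have h1 := hG φ (hchart p) (φ q) (φ.map_source hq)
    rw [φ.left_inv hq] at h1
    rw [← h1, hball _ hqr 0 h0]
  obtain ⟨p₀⟩ : Nonempty M := inferInstance
  have hT : ∀ φ ∈ GCF.charts n M, ∀ x ∈ φ.target, ∀ t ∈ Icc (-ε) ε,
      GCF.translationVector α (GCF.inChart φ F t) (GCF.inChart φ ν t) x = G p₀ := by
    intro φ hφ x hx t ht
    obtain ⟨r, hr, hball⟩ := hlocal φ hφ x hx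
    rw [hball x (Metric.mem_ball_self hr) t ht, hG φ hφ x hx]
    exact hGloc.apply_eq_of_preconnectedSpace _ _
  refine ⟨fun φ hφ x hx t ht i j => ?_, G p₀, hT,
    hconv.isTranslatingSoliton h0 fun φ hφ x hx => hT φ hφ x hx 0 h0⟩
  have hpatch := hconv.isConvexPatch hφ ht
  have hTsmooth := GCF.contDiffOn_slice (t := t)
    (f := fun s => GCF.translationVector α (GCF.inChart φ F s) (GCF.inChart φ ν s))
    (GCF.contDiffOn_translationVector hJ (GCF.contDiffOn_inChart hφ hconv.smooth)
      (GCF.contDiffOn_inChart hφ hconv.smooth_normal) φ.open_target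
      (fun s hs => hconv.isConvexPatch hφ hs) α) ht
  rw [hpatch.chowTensor_eq_inner hx hTsmooth,
    GCF.pd_congr φ.open_target (fun y hy => hT φ hφ y hy t ht) hx]
  simp [GCF.pd]
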